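/- **Potentials.** Let $\mathcal V$ be the set of $V\in C^\infty((0,\infty),\mathbb R)$ such that $V(x)\to+\infty$ as $x\to0^+$; for some $S>0$ one has $V'<0$, $V''>0$ and $V'/V''$ decreasing on $(0,S)$; and the continuous extension of $V'/V''$ to $[0,\infty)$ has a right derivative at $0$ that is less than $-\tfrac12$. Let $\mathcal V^*$ be the set of $V\in\mathcal V$ such that, for every $M\ge1$, $V(\lambda x)/V(\lambda)\to1$ as $\lambda\to0^+$ uniformly in $x\in[1,M]$. Let $R>0$ be such that on $(0,R)$ one has $V'<0$, $V''>0$, $V'/V''$ decreasing and $V'(x)/V''(x)\le -x/2$. **Extended flow.** Consider $\ddot u=\nabla V(|u|)$ in $\mathbb R^2\setminus\{0\}$, that is, $y'=f(y)$ with $y=(x,\dot x)\in\mathbb R^2\times\mathbb R^2$ and $f(x,\dot x)=(\dot x,\nabla V(|x|))$. A datum $\bar y=(\bar q,\bar p)$ with $\bar q\neq 0$ leads to collision at time $T_0>0$ if the classical solution $\bar x$ with this datum exists on $[0,T_0)$, satisfies $0<|\bar x(t)|\le R$ there, and $\bar x(t)\to0$ as $t\to T_0^-$. The extended flow $\Phi(y,t)=(x(t),\dot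 x(t))$, $t\ge0$, defined for data $y$ with non-zero position, follows the classical solution as long as there is no collision, and continues it after each collision instant $c$ by transmission, $x(c+s)=-x(c-s)$; thus after the first collision instant $T_0$ of a collision datum, $x(t)=-\bar x(2T_0-t)$ and $\dot x(t)=\dot{\bar x}(2T_0-t)$ for $T_0<t<2T_0$. It is defined at the pairs $(y,t)$ such that the extended motion from $y$ exists beyond time $t$ and $t$ is not one of its collision instants. **Theorem.** Let $V\in\mathcal V^*$, let $\bar y$ be a datum leading to collision at time $T_0$, let $T>T_0$ be such that $\Phi(\bar y,T)$ is defined (for instance any $T\in(T_0,2T_0)$), and put $y_1=\Phi(\bar y,T)$. Let $\Sigma=\{y:(y-y_1)\cdot F=0\}$, $F\in\mathbb R^2\times\mathbb R^2$, be a hyperplane through $y_1$ transversal to the flow, that is, $F\cdot f(y_1)\neq0$. Then there exist $\delta>0$ and a continuous function $\tau$ on the $\delta$-neighbourhood $N_\delta(\bar y)$ of $\bar y$ such that $\tau(\bar y)=T$ and, for every $y\in N_\delta(\bar y)$, $\Phi(y,\tau(y))$ is defined and $\Phi(y,\tau(y))\in\Sigma$. Moreover the Poincaré section $y\mapsto\Phi(y,\tau(y))$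 is continuous on $N_\delta(\bar y)$. -/

import Mathlib

open Set Filter Topology
open scoped ContDiff

noncomputable section

namespace OneCentre

/-- The configuration plane `ℝ²` with its Euclidean norm. -/
abbrev Plane : Type := EuclideanSpace ℝ (Fin 2)

/-- The phase space `ℝ² × ℝ²` of pairs `(x, ẋ)`. -/
abbrev Phase : Type := Plane × Plane

/-! ### Potentials -/

/-- Conditions ii and iii on the interval `(0, S)`: `V' < 0`, `V'' > 0`, and `V' / V''` is
decreasing (in the weak sense). -/
structure ConvexCondition (V : ℝ → ℝ) (S : ℝ) : Prop where
  deriv_neg : ∀ x ∈ Ioo 0 S, deriv V x < 0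
  deriv2_pos : ∀ x ∈ Ioo 0 S, 0 < deriv (deriv V) x
  ratio_antitone : AntitoneOn (fun x => deriv V x / deriv (deriv V) x) (Ioo 0 S)

/-- The class `𝒱`. Only the values of `V` on `(0, ∞)` matter. In `ratio_deriv_zero` the number `c`
is the value at `0` of the extension of `V' / V''` to `[0, ∞)`; as the extension is differentiable
at `0`, hence continuous, `c` is the limit of `V' / V''` at `0⁺`. -/
structure ClassV (V : ℝ → ℝ) : Prop where
  smooth : ContDiffOn ℝ ∞ V (Ioi 0)
  singular : Tendsto V (𝓝[>] 0) atTop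
  convex : ∃ S : ℝ, 0 < S ∧ ConvexCondition V S
  ratio_deriv_zero : ∃ c d : ℝ,
    HasDerivWithinAt (Function.update (fun x => deriv V x / deriv (deriv V) x) 0 c) d (Ici 0) 0 ∧
      d < -1 / 2

/-- The class `𝒱*`: members of `𝒱` with `V(λx) / V(λ) → 1` as `λ → 0⁺`, uniformly for
`x ∈ [1, M]`, for every `M`. -/
structure ClassVStar (V : ℝ → ℝ) : Prop extends ClassV V where
  slow : ∀ M : ℝ, TendstoUniformlyOn (fun (l : ℝ) (x : ℝ) => V (l * x) / V l) (fun _ => 1)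
    (𝓝[>] 0) (Icc 1 M)

/-- `R = min {T, S}` where conditions ii and iii hold on `(0, S)` and `V' / V'' ≤ -x / 2` holds
on `(0, T)`. -/
structure IsAdmissibleRadius (V : ℝ → ℝ) (R : ℝ) : Prop where
  pos : 0 < R
  convex : ConvexCondition V R
  ratio_le : ∀ x ∈ Ioo 0 R, deriv V x / deriv (deriv V) x ≤ -x / 2

/-! ### The one centre problem and its extended flow -/

/-- The field `f(x, ẋ) = (ẋ, ∇ V(|x|))` on the phase space. -/
def field (V : ℝ → ℝ) (y : Phase) : Phase :=
  (y.2, gradient (fun u : Plane => V ‖u‖) y.1)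

/-- At time `t` the curve `(x, v)` satisfies `ẋ = v`, `v̇ = ∇ V(|x|)` (from the right at `t = 0`). -/
def SolvesAt (V : ℝ → ℝ) (x v : ℝ → Plane) (t : ℝ) : Prop :=
  HasDerivWithinAt x (field V (x t, v t)).1 (Ici 0) t ∧
    HasDerivWithinAt v (field V (x t, v t)).2 (Ici 0) t

/-- The datum `y` leads to a collision at time `T₀`: the classical solution with initial datum `y`
exists on `[0, T₀)`, stays in the ball of radius `R` about the origin, and tends to the origin
as `t → T₀`. -/
def IsCollisionDatum (V : ℝ → ℝ) (R : ℝ) (y : Phase) (T₀ : ℝ) : Prop :=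
  0 < T₀ ∧ ∃ x v : ℝ → Plane, x 0 = y.1 ∧ v 0 = y.2 ∧
    (∀ t ∈ Ico 0 T₀, x t ≠ 0 ∧ ‖x t‖ ≤ R ∧ SolvesAt V x v t) ∧
    Tendsto x (𝓝[<] T₀) (𝓝 0)

/-- An extended motion on `[0, b)` with initial datum `y`, whose position is not the origin: a
continuous curve that is a classical solution away from the origin and that is continued after each
collision instant `c` by transmission, `x(c + s) = -x(c - s)`. The reflection is required for
small `s` only: as `t ↦ -x(2c - t)` solves the same equation, the identity then holds as long as
both sides are defined, so that the motion after the first collision instant `T₀` is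
`t ↦ -x(2T₀ - t)` on `[T₀, 2T₀]`. For a datum that leads to no collision this is the classical
solution. -/
structure IsExtendedMotion (V : ℝ → ℝ) (y : Phase) (b : ℝ) (x v : ℝ → Plane) : Prop where
  ne_zero : y.1 ≠ 0
  init_pos : x 0 = y.1
  init_vel : v 0 = y.2
  cont : ContinuousOn x (Ico 0 b)
  solves : ∀ t ∈ Ico 0 b, x t ≠ 0 → SolvesAt V x v t
  transmission : ∀ c ∈ Ioo 0 b, x c = 0 →
    ∃ η : ℝ, 0 < η ∧ ∀ s ∈ Ioo 0 η, x (c + s) = -x (c - s)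

/-- `z = (x(t), ẋ(t))` for an extended motion with initial datum `y` that is defined up to some
instant after `t ≥ 0`, where `t` is not a collision instant (the velocity is infinite at those). -/
def IsStateAt (V : ℝ → ℝ) (y : Phase) (t : ℝ) (z : Phase) : Prop :=
  0 ≤ t ∧ ∃ (b : ℝ) (x v : ℝ → Plane), t < b ∧ IsExtendedMotion V y b x v ∧ x t ≠ 0 ∧
    z = (x t, v t)

/-- The set of pairs `(y, t)` at which the extended flow is defined. -/
def flowDomain (V : ℝ → ℝ) : Set (Phase × ℝ) := {p | ∃ z, IsStateAt V p.1 p.2 z}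

open Classical in
/-- The extended flow `Φ(y, t)`, with a junk value off `flowDomain V`. -/
def flow (V : ℝ → ℝ) (y : Phase) (t : ℝ) : Phase :=
  if h : ∃ z, IsStateAt V y t z then h.choose else 0

/-! ### Hyperplanes of the phase space -/

/-- The Euclidean scalar product of the phase space. -/
def dot (y z : Phase) : ℝ := inner ℝ y.1 z.1 + inner ℝ y.2 z.2

/-- The hyperplane through `y₁` with normal vector `F` (a hyperplane when `F ≠ 0`). -/
def hyperplane (y₁ F : Phase) : Set Phase := {y | dot (y - y₁) F = 0}

/-- The hyperplane through `y₁` with normal vector `F` is transversal to the flow at `y₁`: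
the field at `y₁` is not tangent to it. In particular `F ≠ 0`. -/
def IsTransversal (V : ℝ → ℝ) (y₁ F : Phase) : Prop := dot (field V y₁) F ≠ 0

end OneCentre

end

noncomputable section

namespace OneCentre

/-! ### The field -/

/-! The core is the joint continuity of the extended flow at every point `(y, t)` of its domain with
`t > 0` (`continuousAt_flow`). Once this is known, transversality makes the scalar product with `F`
strictly monotone in time near the crossing. The crossing time is then found by the intermediate
value theorem and its continuity by monotonicity (`exists_continuousOn_zero`). No differentiability
in the datum is needed.

Continuity across a collision rests on `-r V'(r) = o(V(r))`, which follows from slow variation and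
the monotonicity of `r² V'(r)` (`eventually_virial_le`). Near the centre the kinetic energy
therefore dominates the virial, `x · ẋ` grows at least at unit rate, and `|x|²` is strictly convex
in time. Moreover `r² (E + V) → 0`, so a collision forces zero angular momentum.

Consider a nearby inward datum. If it is radial, it collides and is transmitted exactly to nearly
the antipodal state. If its angular momentum `ℓ` is non-zero, it returns to its initial radius in a
short time. The turning rate of the velocity is compared with the derivative of `arctan (x · ẋ /
ℓ)`, whose total variation is at most `π` whatever `ℓ` is; the direction thus turns by at most `ε π
+ O(|ℓ|)` (`IsArc.turning_le`). At the return `x · ẋ` has changed sign while the velocity has hardly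
changed, so the position is nearly opposite (`norm_add_le_of_reflected`). Both kinds of data come
out where transmission sends the colliding one (`eventually_passage`).

Continuous induction along the motion carries this through any number of collisions
(`stableState_and_conserved`). The duration of a passage is small but not prescribed, hence the
weaker notion `NearlyReaches`; a regular arc after the passage restores exact timing. -/

lemma hasDerivAt_of_smooth {V : ℝ → ℝ} (hV : ContDiffOn ℝ ∞ V (Ioi 0)) {r : ℝ} (hr : 0 < r) :
    HasDerivAt V (deriv V r) r :=
  ((hV.contDiffAt (Ioi_mem_nhds hr)).differentiableAt (by simp)).hasDerivAt

lemma contDiffAt_deriv {V : ℝ → ℝ} (hV : ContDiffOn ℝ ∞ V (Ioi 0)) {r : ℝ} (hr : 0 < r) :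
    ContDiffAt ℝ ∞ (deriv V) r :=
  (((contDiffOn_infty_iff_deriv_of_isOpen isOpen_Ioi).1 hV).2).contDiffAt (Ioi_mem_nhds hr)

/-- Factoring `V ‖u‖` as `s ↦ V (√s)` after the smooth function `‖u‖ ^ 2` reduces the claim to the
chain rule. -/
lemma gradient_radial {V : ℝ → ℝ} (hV : ContDiffOn ℝ ∞ V (Ioi 0)) {u : Plane} (hu : u ≠ 0) :
    gradient (fun u : Plane => V ‖u‖) u = (deriv V ‖u‖ / ‖u‖) • u := by
  have hr : 0 < ‖u‖ := norm_pos_iff.2 hu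
  have h1 : HasFDerivAt (fun u : Plane => ‖u‖ ^ 2) (2 • (innerSL ℝ u)) u :=
    (hasStrictFDerivAt_norm_sq u).hasFDerivAt
  have h2 : HasDerivAt (fun s : ℝ => V (√s)) (deriv V ‖u‖ * (1 / (2 * ‖u‖))) (‖u‖ ^ 2) := by
    have h3 := Real.hasDerivAt_sqrt (x := ‖u‖ ^ 2) (by positivity)
    have h4 : HasDerivAt V (deriv V ‖u‖) (√(‖u‖ ^ 2)) := by
      rw [Real.sqrt_sq hr.le]; exact hasDerivAt_of_smooth hV hr
    have := h4.comp _ h3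
    rwa [Real.sqrt_sq hr.le] at this
  have h5 := h2.comp_hasFDerivAt u h1
  have h6 : (fun s : ℝ => V (√s)) ∘ (fun u : Plane => ‖u‖ ^ 2) = fun u : Plane => V ‖u‖ := by
    funext z; simp
  rw [h6] at h5
  apply HasGradientAt.gradient
  rw [hasGradientAt_iff_hasFDerivAt]
  refine h5.congr_fderiv ?_
  ext z
  simp only [map_smul, smul_apply, smul_eq_mul, InnerProductSpace.toDual_apply_apply,
    innerSL_apply_apply, nsmul_eq_mul, Nat.cast_ofNat]
  field_simp

lemma field_eq {V : ℝ → ℝ} (hV : ContDiffOn ℝ ∞ V (Ioi 0)) {y : Phase} (hy : y.1 ≠ 0) :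
    field V y = (y.2, (deriv V ‖y.1‖ / ‖y.1‖) • y.1) := by
  rw [field, gradient_radial hV hy]

lemma contDiffAt_field {V : ℝ → ℝ} (hV : ContDiffOn ℝ ∞ V (Ioi 0)) {y : Phase} (hy : y.1 ≠ 0) :
    ContDiffAt ℝ 1 (field V) y := by
  have hev : ∀ᶠ z : Phase in 𝓝 y, z.1 ≠ 0 := continuousAt_fst.eventually_ne hy
  have h1 : ContDiffAt ℝ 1
      (fun z : Phase => (z.2, (deriv V ‖z.1‖ / ‖z.1‖) • z.1)) y := by
    have hn : ContDiffAt ℝ 1 (fun z : Phase => ‖z.1‖) y := contDiffAt_fst.norm ℝ hy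
    have hd : ContDiffAt ℝ 1 (fun z : Phase => deriv V ‖z.1‖) y :=
      ContDiffAt.comp (g := deriv V) y
        ((contDiffAt_deriv hV (norm_pos_iff.2 hy)).of_le (by simp)) hn
    exact contDiffAt_snd.prodMk ((hd.div hn (norm_ne_zero_iff.2 hy)).smul contDiffAt_fst)
  exact h1.congr_of_eventuallyEq (hev.mono fun z hz => field_eq hV hz)

lemma solvesAt_iff {V : ℝ → ℝ} {x v : ℝ → Plane} {t : ℝ} :
    SolvesAt V x v t ↔
      HasDerivWithinAt (fun s => (x s, v s)) (field V (x t, v t)) (Ici 0) t :=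
  ⟨fun h => h.1.prodMk h.2, fun h => ⟨h.fst, h.snd⟩⟩

/-- The flow box of the field at a state whose position is not the origin. -/
lemma exists_local_flow {V : ℝ → ℝ} (hV : ContDiffOn ℝ ∞ V (Ioi 0)) {z : Phase} (hz : z.1 ≠ 0) :
    ∃ r > 0, ∃ ε > 0, ∃ α : Phase × ℝ → Phase,
      ContinuousOn α (Metric.ball z r ×ˢ Ioo (-ε) ε) ∧
      ∀ z' ∈ Metric.ball z r, α (z', 0) = z' ∧ ∀ t ∈ Ioo (-ε) ε, (α (z', t)).1 ≠ 0 ∧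
        HasDerivAt (fun s => α (z', s)) (field V (α (z', t))) t := by
  obtain ⟨ε, hε, a, r, _, _, hr, hpl⟩ :=
    IsPicardLindelof.of_contDiffAt_one (contDiffAt_field hV hz)
  obtain ⟨α, h1, h2⟩ := (hpl 0).exists_forall_mem_closedBall_eq_hasDerivWithinAt_continuousOn
  simp only [zero_sub, zero_add] at h1 h2
  have hr' : (0 : ℝ) < r := hr
  have hnhds : Metric.closedBall z (r : ℝ) ×ˢ Icc (-ε) ε ∈ 𝓝 (z, (0 : ℝ)) :=
    prod_mem_nhds (Metric.closedBall_mem_nhds z hr') (Icc_mem_nhds (by linarith) hε)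
  have hc : ContinuousAt α (z, 0) := h2.continuousAt hnhds
  have hne : ∀ᶠ p in 𝓝 (z, (0 : ℝ)), (α p).1 ≠ 0 := by
    refine (continuousAt_fst.comp hc).eventually_ne ?_
    simpa [(h1 z (Metric.mem_closedBall_self hr'.le)).1] using hz
  obtain ⟨d, hd, hball⟩ := Metric.eventually_nhds_iff_ball.1 hne
  refine ⟨min d r, lt_min hd hr', min d ε, lt_min hd hε, α, h2.mono ?_, fun z' hz' => ?_⟩
  · rintro ⟨p, t⟩ ⟨hp, ht⟩
    refine ⟨Metric.ball_subset_closedBall (Metric.ball_subset_ball (min_le_right _ _) hp), ?_⟩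
    have := min_le_right d ε
    exact ⟨by linarith [ht.1], by linarith [ht.2]⟩
  · have hzb : z' ∈ Metric.closedBall z (r : ℝ) :=
      Metric.ball_subset_closedBall (Metric.ball_subset_ball (min_le_right _ _) hz')
    refine ⟨(h1 z' hzb).1, fun t ht => ⟨hball (z', t) ?_, ?_⟩⟩
    · rw [← ball_prod_same]
      refine ⟨Metric.ball_subset_ball (min_le_left _ _) hz', ?_⟩
      have := min_le_left d ε
      rw [Real.ball_eq_Ioo]
      exact ⟨by linarith [ht.1], by linarith [ht.2]⟩
    · have := min_le_right d ε
      have ht1 : -ε < t := by linarith [ht.1]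
      have ht2 : t < ε := by linarith [ht.2]
      exact ((h1 z' hzb).2 t ⟨ht1.le, ht2.le⟩).hasDerivAt (Icc_mem_nhds ht1 ht2)

/-! ### Continuous induction -/

/-- The infimum of the failure times can be neither a failure, by `hlim`, nor a success, by `hstep`.
Both steps may use the whole past, which is what reflection at a collision requires. -/
lemma real_induction {b : ℝ} {P : ℝ → Prop} (h0 : P 0)
    (hlim : ∀ t ∈ Ioo 0 b, (∀ u ∈ Ico 0 t, P u) → P t)
    (hstep : ∀ t ∈ Ico 0 b, (∀ u ∈ Icc 0 t, P u) → ∃ ε > 0, ∀ u ∈ Ioo t (t + ε), u < b → P u) :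
    ∀ t ∈ Ico 0 b, P t := by
  by_contra! hcon
  obtain ⟨t₀, ht₀, hbad⟩ := hcon
  set B : Set ℝ := {t | t ∈ Ico 0 b ∧ ¬ P t}
  have hne : B.Nonempty := ⟨t₀, ht₀, hbad⟩
  have hbdd : BddBelow B := ⟨0, fun t ht => ht.1.1⟩
  set m := sInf B
  have hm0 : 0 ≤ m := le_csInf hne fun t ht => ht.1.1
  have hmb : m < b := (csInf_le hbdd ⟨ht₀, hbad⟩).trans_lt ht₀.2
  have hlt : ∀ u ∈ Ico 0 m, P u := fun u hu => by
    by_contra hP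
    exact absurd (csInf_le hbdd ⟨⟨hu.1, hu.2.trans hmb⟩, hP⟩) (not_le.2 hu.2)
  have hPm : P m := by
    rcases hm0.eq_or_lt with h | h
    · rwa [← h]
    · exact hlim m ⟨h, hmb⟩ hlt
  have hle : ∀ u ∈ Icc 0 m, P u := fun u hu => by
    rcases hu.2.eq_or_lt with h | h
    · rwa [h]
    · exact hlt u ⟨hu.1, h⟩
  obtain ⟨ε, hε, hP⟩ := hstep m ⟨hm0, hmb⟩ hle
  obtain ⟨t, ht, htm⟩ := exists_lt_of_csInf_lt hne (show sInf B < m + ε by linarith)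
  have hmt : m ≤ t := csInf_le hbdd ht
  rcases hmt.eq_or_lt with h | h
  · exact ht.2 (h ▸ hPm)
  · exact ht.2 (hP t ⟨h, htm⟩ ht.1.2)

/-! ### Extended motions: uniqueness -/

namespace IsExtendedMotion

variable {V : ℝ → ℝ} {y : Phase} {b : ℝ} {x v : ℝ → Plane}

lemma mono (h : IsExtendedMotion V y b x v) {b' : ℝ} (hb : b' ≤ b) :
    IsExtendedMotion V y b' x v where
  ne_zero := h.ne_zero
  init_pos := h.init_pos
  init_vel := h.init_vel
  cont := h.cont.mono (Ico_subset_Ico_right hb)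
  solves t ht := h.solves t ⟨ht.1, ht.2.trans_le hb⟩
  transmission c hc := h.transmission c ⟨hc.1, hc.2.trans_le hb⟩

lemma state_zero (h : IsExtendedMotion V y b x v) : (x 0, v 0) = y := by
  rw [h.init_pos, h.init_vel]

lemma hasDerivWithinAt (h : IsExtendedMotion V y b x v) {t : ℝ} (ht : t ∈ Ico 0 b)
    (hx : x t ≠ 0) :
    HasDerivWithinAt (fun s => (x s, v s)) (field V (x t, v t)) (Ici 0) t :=
  solvesAt_iff.1 (h.solves t ht hx)

lemma hasDerivAt (h : IsExtendedMotion V y b x v) {t : ℝ} (ht : t ∈ Ioo 0 b)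
    (hx : x t ≠ 0) :
    HasDerivAt (fun s => (x s, v s)) (field V (x t, v t)) t :=
  (h.hasDerivWithinAt ⟨ht.1.le, ht.2⟩ hx).hasDerivAt (Ici_mem_nhds ht.1)

/-- The velocity is the left derivative of the position, so agreement of the positions up to `t`
suffices and nothing about later times enters. -/
lemma velocity_unique {x' v' : ℝ → Plane} {y' : Phase} {b' : ℝ}
    (h : IsExtendedMotion V y b x v) (h' : IsExtendedMotion V y' b' x' v') {t : ℝ}
    (ht : t ∈ Ioo 0 b) (ht' : t < b') (heq : ∀ u ∈ Icc 0 t, x u = x' u) (hx : x t ≠ 0) :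
    v t = v' t := by
  have hx' : x' t ≠ 0 := by rwa [← heq t ⟨ht.1.le, le_rfl⟩]
  have h1 : HasDerivWithinAt x (v t) (Icc 0 t) t :=
    ((h.solves t ⟨ht.1.le, ht.2⟩ hx).1).mono Icc_subset_Ici_self
  have h2 : HasDerivWithinAt x' (v' t) (Icc 0 t) t :=
    ((h'.solves t ⟨ht.1.le, ht'⟩ hx').1).mono Icc_subset_Ici_self
  have h3 : HasDerivWithinAt x (v' t) (Icc 0 t) t := h2.congr heq (heq t ⟨ht.1.le, le_rfl⟩)
  exact (uniqueDiffOn_Icc ht.1 t ⟨ht.1.le, le_rfl⟩).eq_deriv _ h1 h3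

/-- The field is `C¹`, hence Lipschitz, near a state off the centre. The equation is assumed only
off the centre, so the interval is shortened until both curves stay away from it. -/
lemma eq_right_of_eq (hV : ContDiffOn ℝ ∞ V (Ioi 0)) {w w' : ℝ → Phase} {t b : ℝ} (hb : t < b)
    (h : ∀ s ∈ Ico t b, (w s).1 ≠ 0 → HasDerivWithinAt w (field V (w s)) (Ici t) s)
    (h' : ∀ s ∈ Ico t b, (w' s).1 ≠ 0 → HasDerivWithinAt w' (field V (w' s)) (Ici t) s)
    (heq : w t = w' t) (hx : (w t).1 ≠ 0) :
    ∃ ε > 0, ∀ u ∈ Ioo t (t + ε), w u = w' u := by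
  obtain ⟨K, s, hs, hl⟩ := (contDiffAt_field hV hx).exists_lipschitzOnWith
  have hs' : s ∩ {z : Phase | z.1 ≠ 0} ∈ 𝓝 (w t) :=
    inter_mem hs (continuousAt_fst.eventually_ne hx)
  have hmem : t ∈ Ico t b := ⟨le_rfl, hb⟩
  have e1 : ∀ᶠ u in 𝓝[≥] t, w u ∈ s ∩ {z : Phase | z.1 ≠ 0} :=
    (h t hmem hx).continuousWithinAt hs'
  have e2 : ∀ᶠ u in 𝓝[≥] t, w' u ∈ s ∩ {z : Phase | z.1 ≠ 0} :=
    (h' t hmem (heq ▸ hx)).continuousWithinAt (heq ▸ hs')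
  obtain ⟨d, hd, hsub⟩ := mem_nhdsGE_iff_exists_Ico_subset.1 (e1.and e2)
  have hd' : t < d := hd
  refine ⟨min d b - t, sub_pos.2 (lt_min hd' hb), fun u hu => ?_⟩
  have hud : u < d := by linarith [hu.2, min_le_left d b]
  have hub : u < b := by linarith [hu.2, min_le_right d b]
  have hin : ∀ τ ∈ Icc t u, (w τ ∈ s ∧ (w τ).1 ≠ 0) ∧ w' τ ∈ s ∧ (w' τ).1 ≠ 0 :=
    fun τ hτ => hsub ⟨hτ.1, hτ.2.trans_lt hud⟩
  have hw : ∀ τ ∈ Icc t u, HasDerivWithinAt w (field V (w τ)) (Ici t) τ :=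
    fun τ hτ => h τ ⟨hτ.1, hτ.2.trans_lt hub⟩ (hin τ hτ).1.2
  have hw' : ∀ τ ∈ Icc t u, HasDerivWithinAt w' (field V (w' τ)) (Ici t) τ :=
    fun τ hτ => h' τ ⟨hτ.1, hτ.2.trans_lt hub⟩ (hin τ hτ).2.2
  have hIco : ∀ τ ∈ Ico t u, τ ∈ Icc t u := fun τ hτ => Ico_subset_Icc_self hτ
  exact ODE_solution_unique_of_mem_Icc_right (v := fun _ => field V) (s := fun _ => s)
    (fun _ _ => hl)
    (fun τ hτ => (hw τ hτ).continuousWithinAt.mono Icc_subset_Ici_self)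
    (fun τ hτ => (hw τ (hIco τ hτ)).mono (Ici_subset_Ici.2 hτ.1))
    (fun τ hτ => (hin τ (hIco τ hτ)).1.1)
    (fun τ hτ => (hw' τ hτ).continuousWithinAt.mono Icc_subset_Ici_self)
    (fun τ hτ => (hw' τ (hIco τ hτ)).mono (Ici_subset_Ici.2 hτ.1))
    (fun τ hτ => (hin τ (hIco τ hτ)).2.1) heq ⟨hu.1.le, le_rfl⟩

/-- The position of an extended motion is determined by the datum. -/
lemma position_unique (hV : ContDiffOn ℝ ∞ V (Ioi 0)) {x' v' : ℝ → Plane}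
    (h : IsExtendedMotion V y b x v) (h' : IsExtendedMotion V y b x' v') :
    ∀ t ∈ Ico 0 b, x t = x' t := by
  refine real_induction (by rw [h.init_pos, h'.init_pos]) (fun t ht hP => ?_) (fun t ht hP => ?_)
  · have hs : Ico 0 t ⊆ Ico 0 b := Ico_subset_Ico_right ht.2.le
    have hcl : t ∈ closure (Ico 0 t) := by
      rw [closure_Ico ht.1.ne]; exact ⟨ht.1.le, le_rfl⟩
    have : (𝓝[Ico 0 t] t).NeBot := mem_closure_iff_nhdsWithin_neBot.1 hcl
    have h1 : Tendsto x (𝓝[Ico 0 t] t) (𝓝 (x t)) := (h.cont t ⟨ht.1.le, ht.2⟩).mono hs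
    have h2 : Tendsto x' (𝓝[Ico 0 t] t) (𝓝 (x' t)) := (h'.cont t ⟨ht.1.le, ht.2⟩).mono hs
    exact tendsto_nhds_unique_of_eventuallyEq h1 h2 (eventually_mem_nhdsWithin.mono hP)
  · have hxt := hP t ⟨ht.1, le_rfl⟩
    by_cases hx : x t = 0
    · have ht0 : 0 < t := by
        rcases ht.1.eq_or_lt with h0 | h0
        · rw [← h0, h.init_pos] at hx; exact absurd hx h.ne_zero
        · exact h0
      obtain ⟨η, hη, hr⟩ := h.transmission t ⟨ht0, ht.2⟩ hx
      obtain ⟨η', hη', hr'⟩ := h'.transmission t ⟨ht0, ht.2⟩ (hxt ▸ hx)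
      -- Reflection expresses the position at `u` by that at `2t - u`, where the curves already
      -- agree; the bound by `t` keeps this time non-negative.
      refine ⟨min t (min η η'), lt_min ht0 (lt_min hη hη'), fun u hu _ => ?_⟩
      have a1 := min_le_left t (min η η')
      have a2 := (min_le_right t (min η η')).trans (min_le_left _ _)
      have a3 := (min_le_right t (min η η')).trans (min_le_right _ _)
      have b1 := hr (u - t) ⟨by linarith [hu.1], by linarith [hu.2]⟩
      have b2 := hr' (u - t) ⟨by linarith [hu.1], by linarith [hu.2]⟩
      rw [add_sub_cancel] at b1 b2
      rw [b1, b2, hP _ ⟨by linarith [hu.2], by linarith [hu.1]⟩]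
    · have hvt : v t = v' t := by
        rcases ht.1.eq_or_lt with h0 | h0
        · rw [← h0, h.init_vel, h'.init_vel]
        · exact velocity_unique h h' ⟨h0, ht.2⟩ ht.2 hP hx
      obtain ⟨ε, hε, he⟩ := eq_right_of_eq hV (w := fun s => (x s, v s))
        (w' := fun s => (x' s, v' s)) ht.2
        (fun s hs hne => (h.hasDerivWithinAt ⟨ht.1.trans hs.1, hs.2⟩ hne).mono
          (Ici_subset_Ici.2 ht.1))
        (fun s hs hne => (h'.hasDerivWithinAt ⟨ht.1.trans hs.1, hs.2⟩ hne).mono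
          (Ici_subset_Ici.2 ht.1))
        (Prod.ext hxt hvt) hx
      exact ⟨ε, hε, fun u hu _ => congrArg Prod.fst (he u hu)⟩

lemma state_unique (hV : ContDiffOn ℝ ∞ V (Ioi 0)) {x' v' : ℝ → Plane} {b' : ℝ}
    (h : IsExtendedMotion V y b x v) (h' : IsExtendedMotion V y b' x' v') {t : ℝ} (h0 : 0 ≤ t)
    (ht : t < b) (ht' : t < b') (hx : x t ≠ 0) : (x t, v t) = (x' t, v' t) := by
  have hm := position_unique hV (h.mono (min_le_left b b')) (h'.mono (min_le_right b b'))
  have htm : t < min b b' := lt_min ht ht'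
  refine Prod.ext (hm t ⟨h0, htm⟩) ?_
  rcases h0.eq_or_lt with h0 | h0
  · simp only [← h0, h.init_vel, h'.init_vel]
  · exact velocity_unique h h' ⟨h0, ht⟩ ht' (fun u hu => hm u ⟨hu.1, hu.2.trans_lt htm⟩) hx

end IsExtendedMotion

/-- A classical solution is an extended motion. -/
lemma isExtendedMotion_of_classical {V : ℝ → ℝ} {y : Phase} {b : ℝ} {w : ℝ → Phase}
    (h0 : w 0 = y) (hy : y.1 ≠ 0)
    (hw : ∀ t ∈ Ico 0 b, (w t).1 ≠ 0 ∧ HasDerivWithinAt w (field V (w t)) (Ici 0) t) :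
    IsExtendedMotion V y b (fun t => (w t).1) (fun t => (w t).2) where
  ne_zero := hy
  init_pos := by rw [h0]
  init_vel := by rw [h0]
  cont t ht := ((hw t ht).2.continuousWithinAt.fst).mono Ico_subset_Ici_self
  solves t ht _ := solvesAt_iff.2 (hw t ht).2
  transmission c hc h := absurd h (hw c ⟨hc.1.le, hc.2⟩).1

/-! ### Concatenation -/

section Concat

variable {E : Type*}

/-- The curve `f` up to the time `t`, followed by the curve `g`. -/
def concat (t : ℝ) (f g : ℝ → E) (u : ℝ) : E := if u ≤ t then f u else g (u - t)

lemma concat_of_le {t u : ℝ} (f g : ℝ → E) (h : u ≤ t) : concat t f g u = f u := if_pos h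

lemma concat_of_ge {t u : ℝ} {f g : ℝ → E} (hfg : f t = g 0) (h : t ≤ u) :
    concat t f g u = g (u - t) := by
  rcases h.eq_or_lt with h | h
  · subst h; rw [concat_of_le f g le_rfl, hfg, sub_self]
  · exact if_neg (not_le.2 h)

lemma concat_eventuallyEq_left {t u : ℝ} (f g : ℝ → E) (h : u < t) : concat t f g =ᶠ[𝓝 u] f :=
  mem_of_superset (Iio_mem_nhds h) fun _ hs => concat_of_le f g (le_of_lt hs)

lemma concat_eventuallyEq_right {t u : ℝ} {f g : ℝ → E} (h : t < u) :
    concat t f g =ᶠ[𝓝 u] fun s => g (s - t) :=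
  mem_of_superset (Ioi_mem_nhds h) fun _ hs => if_neg (not_le.2 hs)

variable [NormedAddCommGroup E]

lemma continuousOn_concat {t b c : ℝ} {f g : ℝ → E} (hfg : f t = g 0) (ht : t ∈ Ico 0 b)
    (hf : ContinuousOn f (Ico 0 b)) (hg : ContinuousOn g (Ico 0 c)) :
    ContinuousOn (concat t f g) (Ico 0 (t + c)) := by
  have h1 : ContinuousOn (concat t f g) (Icc 0 t) :=
    (hf.mono (Icc_subset_Ico_right ht.2)).congr fun u hu => concat_of_le f g hu.2
  have h2 : ContinuousOn (concat t f g) (Ico t (t + c)) := by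
    refine (hg.comp (f := fun u => u - t) (by fun_prop) ?_).congr
      fun u hu => concat_of_ge hfg hu.1
    exact fun u hu => ⟨by linarith [hu.1], by linarith [hu.2]⟩
  intro u hu
  rcases lt_trichotomy u t with h | h | h
  · exact ((h1 u ⟨hu.1, h.le⟩).mono_of_mem_nhdsWithin
      (mem_nhdsWithin.2 ⟨Iio t, isOpen_Iio, h, fun s hs => ⟨hs.2.1, (le_of_lt hs.1)⟩⟩))
  · subst h
    refine ((h1 u ⟨hu.1, le_rfl⟩).union (h2 u ⟨le_rfl, hu.2⟩)).mono fun s hs => ?_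
    rcases le_total s u with h | h
    · exact Or.inl ⟨hs.1, h⟩
    · exact Or.inr ⟨h, hs.2⟩
  · exact ((h2 u ⟨h.le, hu.2⟩).mono_of_mem_nhdsWithin
      (mem_nhdsWithin.2 ⟨Ioi t, isOpen_Ioi, h, fun s hs => ⟨le_of_lt hs.1, hs.2.2⟩⟩))

variable [NormedSpace ℝ E]

lemma hasDerivWithinAt_concat {t u : ℝ} {f g : ℝ → E} {e : E} (hfg : f t = g 0)
    (hf : u ≤ t → HasDerivWithinAt f e (Ici 0) u)
    (hg : t ≤ u → HasDerivWithinAt g e (Ici 0) (u - t)) :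
    HasDerivWithinAt (concat t f g) e (Ici 0) u := by
  have hshift : t ≤ u → HasDerivWithinAt (fun s => g (s - t)) e (Ici t) u := fun h => by
    have := (hg h).scomp u ((hasDerivWithinAt_id u (Ici t)).sub_const t)
      (fun s hs => sub_nonneg.2 hs)
    simpa using! this
  rcases lt_trichotomy u t with h | h | h
  · exact (hf h.le).congr_of_eventuallyEq ((concat_eventuallyEq_left f g h).filter_mono
      nhdsWithin_le_nhds) (concat_of_le f g h.le)
  · subst h
    have h1 : HasDerivWithinAt (concat u f g) e (Icc 0 u) u :=
      ((hf le_rfl).mono Icc_subset_Ici_self).congr (fun s hs => concat_of_le f g hs.2)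
        (concat_of_le f g le_rfl)
    have h2 : HasDerivWithinAt (concat u f g) e (Ici u) u :=
      (hshift le_rfl).congr (fun s hs => concat_of_ge hfg hs) (concat_of_ge hfg le_rfl)
    refine (h1.union h2).mono fun s hs => ?_
    rcases le_total s u with h | h
    · exact Or.inl ⟨hs, h⟩
    · exact Or.inr h
  · exact (((hshift h.le).hasDerivAt (Ici_mem_nhds h)).congr_of_eventuallyEq
      (concat_eventuallyEq_right h)).hasDerivWithinAt

end Concat

lemma IsExtendedMotion.concat {V : ℝ → ℝ} {y : Phase} {b c t : ℝ} {x v x' v' : ℝ → Plane}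
    (h : IsExtendedMotion V y b x v) (ht : t ∈ Ico 0 b)
    (h' : IsExtendedMotion V (x t, v t) c x' v') :
    IsExtendedMotion V y (t + c) (concat t x x') (concat t v v') := by
  have ex : x t = x' 0 := h'.init_pos.symm
  have ev : v t = v' 0 := h'.init_vel.symm
  refine ⟨h.ne_zero, ?_, ?_, continuousOn_concat ex ht h.cont h'.cont, fun u hu hne => ?_,
    fun s hs hx => ?_⟩
  · rw [concat_of_le _ _ ht.1, h.init_pos]
  · rw [concat_of_le _ _ ht.1, h.init_vel]
  · have key1 : u ≤ t → SolvesAt V x v u := fun hut =>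
      h.solves u ⟨hu.1, hut.trans_lt ht.2⟩ (by rwa [concat_of_le _ _ hut] at hne)
    have key2 : t ≤ u → SolvesAt V x' v' (u - t) := fun hut =>
      h'.solves (u - t) ⟨by linarith, by linarith [hu.2]⟩ (by rwa [concat_of_ge ex hut] at hne)
    constructor
    · refine hasDerivWithinAt_concat ex (fun hut => ?_) (fun hut => ?_)
      · rw [concat_of_le _ _ hut, concat_of_le _ _ hut]; exact (key1 hut).1
      · rw [concat_of_ge ex hut, concat_of_ge ev hut]; exact (key2 hut).1
    · refine hasDerivWithinAt_concat ev (fun hut => ?_) (fun hut => ?_)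
      · rw [concat_of_le _ _ hut, concat_of_le _ _ hut]; exact (key1 hut).2
      · rw [concat_of_ge ex hut, concat_of_ge ev hut]; exact (key2 hut).2
  · rcases lt_trichotomy s t with hst | hst | hst
    · rw [concat_of_le _ _ hst.le] at hx
      obtain ⟨η, hη, hr⟩ := h.transmission s ⟨hs.1, hst.trans ht.2⟩ hx
      refine ⟨min η (t - s), lt_min hη (sub_pos.2 hst), fun r hr' => ?_⟩
      have a1 := min_le_left η (t - s)
      have a2 := min_le_right η (t - s)
      rw [concat_of_le _ _ (by linarith [hr'.2]), concat_of_le _ _ (by linarith [hr'.1])]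
      exact hr r ⟨hr'.1, by linarith [hr'.2]⟩
    -- The junction is no collision instant, because the second motion starts off the centre.
    · subst hst
      rw [concat_of_le _ _ le_rfl] at hx
      exact absurd hx h'.ne_zero
    · rw [concat_of_ge ex hst.le] at hx
      obtain ⟨η, hη, hr⟩ := h'.transmission (s - t) ⟨by linarith, by linarith [hs.2]⟩ hx
      refine ⟨min η (s - t), lt_min hη (sub_pos.2 hst), fun r hr' => ?_⟩
      have a1 := min_le_left η (s - t)
      have a2 := min_le_right η (s - t)
      rw [concat_of_ge ex (by linarith [hr'.1]), concat_of_ge ex (by linarith [hr'.2])]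
      have := hr r ⟨hr'.1, by linarith [hr'.2]⟩
      rw [show s + r - t = s - t + r by ring, show s - r - t = s - t - r by ring, this]

/-! ### States of the extended flow -/

section States

variable {V : ℝ → ℝ}

lemma IsExtendedMotion.isStateAt {y : Phase} {b t : ℝ} {x v : ℝ → Plane}
    (h : IsExtendedMotion V y b x v) (ht : t ∈ Ico 0 b) (hx : x t ≠ 0) :
    IsStateAt V y t (x t, v t) :=
  ⟨ht.1, b, x, v, ht.2, h, hx, rfl⟩

lemma IsStateAt.ne_zero {y z : Phase} {t : ℝ} (h : IsStateAt V y t z) : z.1 ≠ 0 := by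
  obtain ⟨_, b, x, v, _, _, hx, rfl⟩ := h
  exact hx

lemma IsStateAt.unique (hV : ContDiffOn ℝ ∞ V (Ioi 0)) {y z z' : Phase} {t : ℝ}
    (h : IsStateAt V y t z) (h' : IsStateAt V y t z') : z = z' := by
  obtain ⟨h0, b, x, v, hb, hm, hx, rfl⟩ := h
  obtain ⟨_, b', x', v', hb', hm', _, rfl⟩ := h'
  exact hm.state_unique hV hm' h0 hb hb' hx

/-- This is the semigroup law, obtained by concatenating motions. -/
lemma IsStateAt.trans {y z w : Phase} {t s : ℝ} (h : IsStateAt V y t z) (h' : IsStateAt V z s w) :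
    IsStateAt V y (t + s) w := by
  obtain ⟨h0, b, x, v, hb, hm, hx, rfl⟩ := h
  obtain ⟨h0', c, x', v', hc, hm', hx', rfl⟩ := h'
  have ex : x t = x' 0 := hm'.init_pos.symm
  have ev : v t = v' 0 := hm'.init_vel.symm
  have hst : t ≤ t + s := by linarith
  refine ⟨by linarith, t + c, _, _, by linarith, hm.concat ⟨h0, hb⟩ hm', ?_, ?_⟩
  · rwa [concat_of_ge ex hst, add_sub_cancel_left]
  · rw [concat_of_ge ex hst, concat_of_ge ev hst, add_sub_cancel_left]

lemma flow_eq (hV : ContDiffOn ℝ ∞ V (Ioi 0)) {y z : Phase} {t : ℝ} (h : IsStateAt V y t z) :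
    flow V y t = z := by
  have hex : ∃ z, IsStateAt V y t z := ⟨z, h⟩
  rw [flow, dif_pos hex]
  exact hex.choose_spec.unique hV h

end States

/-! ### Continuous dependence on the datum -/

section Dependence

variable {V : ℝ → ℝ}

/-- Data near `y` have, at times near `t`, a state near `z`. -/
def StableState (V : ℝ → ℝ) (y : Phase) (t : ℝ) (z : Phase) : Prop :=
  ∀ U ∈ 𝓝 z, ∀ᶠ p : Phase × ℝ in 𝓝 (y, t), 0 ≤ p.2 → ∃ z' ∈ U, IsStateAt V p.1 p.2 z'

/-- Data near `y` have a state near `z` at some time near `t`. -/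
def NearlyReaches (V : ℝ → ℝ) (y : Phase) (t : ℝ) (z : Phase) : Prop :=
  ∀ U ∈ 𝓝 z, ∀ η > 0, ∀ᶠ y' in 𝓝 y, ∃ t' ≥ 0, |t' - t| < η ∧ ∃ z' ∈ U, IsStateAt V y' t' z'

lemma StableState.nearlyReaches {y z : Phase} {t : ℝ} (ht : 0 ≤ t) (h : StableState V y t z) :
    NearlyReaches V y t z := by
  intro U hU η hη
  have h1 : Tendsto (fun y' : Phase => (y', t)) (𝓝 y) (𝓝 (y, t)) :=
    (Continuous.prodMk_left t).tendsto y
  exact (h1.eventually (h U hU)).mono fun y' hy' => ⟨t, ht, by simpa using hη, hy' ht⟩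

/-- The error in the intermediate time is absorbed because `StableState` also allows the time to
vary. Positivity of `s` ensures that the remaining duration `p.2 - t'` is non-negative. -/
lemma NearlyReaches.trans_stableState {y z w : Phase} {t s : ℝ} (hs : 0 < s)
    (h : NearlyReaches V y t z) (h' : StableState V z s w) : StableState V y (t + s) w := by
  intro U hU
  obtain ⟨A, hA, B, hB, hAB⟩ := mem_nhds_prod_iff.1 (h' U hU)
  obtain ⟨η, hη, hBη⟩ := Metric.mem_nhds_iff.1 hB
  have hη' : 0 < min (η / 2) (s / 2) := lt_min (by linarith) (by linarith)
  have h1 : ∀ᶠ p : Phase × ℝ in 𝓝 (y, t + s), ∃ t' ≥ 0, |t' - t| < min (η / 2) (s / 2) ∧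
      ∃ z' ∈ A, IsStateAt V p.1 t' z' :=
    (continuous_fst.tendsto (y, t + s)).eventually (h A hA _ hη')
  have h2 : ∀ᶠ p : Phase × ℝ in 𝓝 (y, t + s), dist p.2 (t + s) < min (η / 2) (s / 2) :=
    (continuous_snd.tendsto (y, t + s)).eventually (Metric.ball_mem_nhds (t + s) hη')
  filter_upwards [h1, h2] with p ⟨t', ht', htt, z', hz', hst⟩ hp _
  rw [Real.dist_eq] at hp
  have m1 := min_le_left (η / 2) (s / 2)
  have m2 := min_le_right (η / 2) (s / 2)
  rw [abs_lt] at htt hp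
  have hmem : (z', p.2 - t') ∈ A ×ˢ B := by
    refine ⟨hz', hBη ?_⟩
    rw [Metric.mem_ball, Real.dist_eq, abs_lt]
    constructor <;> linarith [htt.1, htt.2, hp.1, hp.2]
  obtain ⟨z'', hz'', hst'⟩ := hAB hmem (by simp only; linarith [htt.1, htt.2, hp.1, hp.2])
  refine ⟨z'', hz'', ?_⟩
  have := hst.trans hst'
  rwa [add_sub_cancel] at this

lemma StableState.trans {y z w : Phase} {t s : ℝ} (ht : 0 ≤ t) (hs : 0 < s)
    (h : StableState V y t z) (h' : StableState V z s w) : StableState V y (t + s) w :=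
  (h.nearlyReaches ht).trans_stableState hs h'

/-- Near a state whose position is not the origin, all data have a classical solution on a common
time interval, and it depends continuously on the datum. -/
lemma exists_local_motion (hV : ContDiffOn ℝ ∞ V (Ioi 0)) {z : Phase} (hz : z.1 ≠ 0) :
    ∃ r > 0, ∃ ε > 0, ∀ z' ∈ Metric.ball z r, ∃ x v, IsExtendedMotion V z' ε x v ∧
      ∀ t ∈ Ico 0 ε, x t ≠ 0 ∧ StableState V z' t (x t, v t) := by
  obtain ⟨r, hr, ε, hε, α, hα, h⟩ := exists_local_flow hV hz
  have hsub : ∀ t ∈ Ico 0 ε, t ∈ Ioo (-ε) ε := fun t ht => ⟨by linarith [ht.1], ht.2⟩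
  have hmot : ∀ z' ∈ Metric.ball z r,
      IsExtendedMotion V z' ε (fun t => (α (z', t)).1) (fun t => (α (z', t)).2) := by
    intro z' hz'
    refine isExtendedMotion_of_classical (h z' hz').1 ?_ fun t ht =>
      ⟨((h z' hz').2 t (hsub t ht)).1, ((h z' hz').2 t (hsub t ht)).2.hasDerivWithinAt⟩
    have := ((h z' hz').2 0 (hsub 0 ⟨le_rfl, hε⟩)).1
    rwa [(h z' hz').1] at this
  refine ⟨r, hr, ε, hε, fun z' hz' => ⟨_, _, hmot z' hz', fun t ht =>
    ⟨((h z' hz').2 t (hsub t ht)).1, fun U hU => ?_⟩⟩⟩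
  have hopen : Metric.ball z r ×ˢ Ioo (-ε) ε ∈ 𝓝 (z', t) :=
    prod_mem_nhds (Metric.isOpen_ball.mem_nhds hz') (isOpen_Ioo.mem_nhds (hsub t ht))
  have hc : ContinuousAt α (z', t) := hα.continuousAt hopen
  filter_upwards [hopen, hc hU] with p hp hpU hp0
  exact ⟨α p, hpU, (hmot p.1 hp.1).isStateAt ⟨hp0, hp.2.2⟩ ((h p.1 hp.1).2 p.2 hp.2).1⟩

namespace IsExtendedMotion

variable {y : Phase} {b : ℝ} {x v : ℝ → Plane}

lemma shift (h : IsExtendedMotion V y b x v) {t : ℝ} (ht : t ∈ Ico 0 b) (hx : x t ≠ 0) :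
    IsExtendedMotion V (x t, v t) (b - t) (fun s => x (t + s)) (fun s => v (t + s)) := by
  have hmem : ∀ s ∈ Ico 0 (b - t), t + s ∈ Ico 0 b :=
    fun s hs => ⟨by linarith [ht.1, hs.1], by linarith [hs.2]⟩
  have hder : ∀ {f : ℝ → Plane} {e : Plane} {s : ℝ}, HasDerivWithinAt f e (Ici 0) (t + s) →
      HasDerivWithinAt (fun s => f (t + s)) e (Ici 0) s := fun {f e s} hf => by
    have := hf.scomp s ((hasDerivWithinAt_id s (Ici 0)).const_add t)
      (fun u hu => add_nonneg ht.1 hu)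
    simpa using! this
  refine ⟨hx, by simp, by simp, h.cont.comp (f := fun s => t + s) (by fun_prop) hmem,
    fun s hs hne => ?_, fun c hc hx0 => ?_⟩
  · have := h.solves (t + s) (hmem s hs) hne
    exact ⟨hder this.1, hder this.2⟩
  · obtain ⟨η, hη, hr⟩ := h.transmission (t + c) ⟨by linarith [ht.1, hc.1], by linarith [hc.2]⟩ hx0
    exact ⟨η, hη, fun s hs => by
      have := hr s hs
      rwa [add_assoc, add_sub_assoc] at this⟩

lemma continuousWithinAt_state (h : IsExtendedMotion V y b x v) {t : ℝ} (ht : t ∈ Ico 0 b)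
    (hx : x t ≠ 0) : ContinuousWithinAt (fun s => (x s, v s)) (Ici 0) t :=
  (h.hasDerivWithinAt ht hx).continuousWithinAt

lemma stableState_of_ne_zero (hV : ContDiffOn ℝ ∞ V (Ioi 0)) (h : IsExtendedMotion V y b x v) :
    ∀ t ∈ Ico 0 b, (∀ s ∈ Icc 0 t, x s ≠ 0) → StableState V y t (x t, v t) := by
  -- The local motion started at time `t` arrives at the state at time `u` by uniqueness, so the two
  -- stability statements compose.
  have hadv : ∀ {t u ε : ℝ} {x' v' : ℝ → Plane}, 0 ≤ t → t < u → u < b → u < t + ε → x t ≠ 0 →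
      x u ≠ 0 → StableState V y t (x t, v t) → IsExtendedMotion V (x t, v t) ε x' v' →
      (∀ s ∈ Ico 0 ε, x' s ≠ 0 ∧ StableState V (x t, v t) s (x' s, v' s)) →
      StableState V y u (x u, v u) := by
    intro t u ε x' v' h0 htu hub huε hxt hxu hst hm hs
    have hmem : u - t ∈ Ico 0 ε := ⟨by linarith, by linarith⟩
    have h1 := (h.isStateAt ⟨h0, htu.trans hub⟩ hxt).trans (hm.isStateAt hmem (hs _ hmem).1)
    rw [add_sub_cancel] at h1
    have h2 := h1.unique hV (h.isStateAt ⟨h0.trans htu.le, hub⟩ hxu)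
    have h3 := hst.trans h0 (by linarith : 0 < u - t) (hs _ hmem).2
    rwa [add_sub_cancel, h2] at h3
  refine real_induction (fun _ => ?_) (fun t ht hP hne => ?_) (fun t ht hP => ?_)
  · obtain ⟨r, hr, ε, hε, hl⟩ := exists_local_motion hV h.ne_zero
    obtain ⟨x', v', hm, hs⟩ := hl y (Metric.mem_ball_self hr)
    have := (hs 0 ⟨le_rfl, hε⟩).2
    rw [h.state_zero]
    rwa [hm.state_zero] at this
  · have hxt := hne t ⟨ht.1.le, le_rfl⟩
    obtain ⟨r, hr, ε, hε, hl⟩ := exists_local_motion hV (z := (x t, v t)) hxt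
    have hc : ContinuousAt (fun s => (x s, v s)) t :=
      (h.continuousWithinAt_state ⟨ht.1.le, ht.2⟩ hxt).continuousAt (Ici_mem_nhds ht.1)
    have e1 : ∀ᶠ s in 𝓝[<] t, (x s, v s) ∈ Metric.ball (x t, v t) r :=
      nhdsWithin_le_nhds (hc (Metric.ball_mem_nhds _ hr))
    have e2 : ∀ᶠ s in 𝓝[<] t, s ∈ Ioo (max 0 (t - ε)) t :=
      Ioo_mem_nhdsLT (max_lt ht.1 (by linarith))
    -- The lifespan `ε` is common to the whole ball, so a local motion started shortly before `t`
    -- passes beyond `t`.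
    obtain ⟨s, hs1, hs2⟩ := (e1.and e2).exists
    obtain ⟨x', v', hm, hs⟩ := hl _ hs1
    have a1 := (le_max_left 0 (t - ε)).trans_lt hs2.1
    have a2 := (le_max_right 0 (t - ε)).trans_lt hs2.1
    exact hadv a1.le hs2.2 ht.2 (by linarith) (hne s ⟨a1.le, hs2.2.le⟩) hxt
      (hP s ⟨a1.le, hs2.2⟩ fun u hu => hne u ⟨hu.1, hu.2.trans hs2.2.le⟩) hm hs
  · by_cases hxt : x t = 0
    · exact ⟨1, one_pos, fun u hu _ hne => absurd hxt (hne t ⟨ht.1, hu.1.le⟩)⟩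
    · obtain ⟨r, hr, ε, hε, hl⟩ := exists_local_motion hV (z := (x t, v t)) hxt
      obtain ⟨x', v', hm, hs⟩ := hl _ (Metric.mem_ball_self hr)
      exact ⟨ε, hε, fun u hu hub hne => hadv ht.1 hu.1 hub hu.2 hxt
        (hne u ⟨ht.1.trans hu.1.le, le_rfl⟩)
        (hP t ⟨ht.1, le_rfl⟩ fun s hs => hne s ⟨hs.1, hs.2.trans hu.1.le⟩) hm hs⟩

/-- Continuous dependence along an arc without collision. -/
lemma stableState_arc (hV : ContDiffOn ℝ ∞ V (Ioi 0)) (h : IsExtendedMotion V y b x v)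
    {t₁ t₂ : ℝ} (h1 : 0 ≤ t₁) (h12 : t₁ ≤ t₂) (h2 : t₂ < b) (hne : ∀ s ∈ Icc t₁ t₂, x s ≠ 0) :
    StableState V (x t₁, v t₁) (t₂ - t₁) (x t₂, v t₂) := by
  have hm := h.shift ⟨h1, h12.trans_lt h2⟩ (hne t₁ ⟨le_rfl, h12⟩)
  have := hm.stableState_of_ne_zero hV (t₂ - t₁) ⟨by linarith, by linarith⟩
    fun s hs => hne _ ⟨by linarith [hs.1], by linarith [hs.2]⟩
  simpa using this

end IsExtendedMotion

/-! ### Maximal classical solutions -/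

/-- The classical solution up to the time `B`, or up to its blow-up or collision. -/
lemma exists_maximal_motion (hV : ContDiffOn ℝ ∞ V (Ioi 0)) {y : Phase} (hy : y.1 ≠ 0) {B : ℝ}
    (hB : 0 < B) : ∃ b ∈ Ioc 0 B, ∃ x v, IsExtendedMotion V y b x v ∧ (∀ t ∈ Ico 0 b, x t ≠ 0) ∧
      (b = B ∨ ∀ K : Set Phase, IsCompact K → (∀ z ∈ K, z.1 ≠ 0) → ∀ t₀ < b,
        ∃ t ∈ Ico 0 b, t₀ < t ∧ (x t, v t) ∉ K) := by
  set S : Set ℝ := {b | b ∈ Ioc 0 B ∧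
    ∃ x v, IsExtendedMotion V y b x v ∧ ∀ t ∈ Ico 0 b, x t ≠ 0} with hS
  have hSne : S.Nonempty := by
    obtain ⟨r, hr, ε, hε, hl⟩ := exists_local_motion hV hy
    obtain ⟨x, v, hm, hs⟩ := hl y (Metric.mem_ball_self hr)
    exact ⟨min ε B, ⟨lt_min hε hB, min_le_right _ _⟩, x, v, hm.mono (min_le_left _ _),
      fun t ht => (hs t ⟨ht.1, ht.2.trans_le (min_le_left _ _)⟩).1⟩
  have hbdd : BddAbove S := ⟨B, fun b hb => hb.1.2⟩
  obtain ⟨b₀, hb₀⟩ := hSne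
  set b := sSup S with hb
  have hbpos : 0 < b := hb₀.1.1.trans_le (le_csSup hbdd hb₀)
  have hbB : b ≤ B := csSup_le ⟨b₀, hb₀⟩ fun b hb => hb.1.2
  -- Uniqueness of states lets the motions on shorter intervals be glued into one curve `w`.
  have hex : ∀ t, ∃ w : Phase, t ∈ Ico 0 b → IsStateAt V y t w ∧ ∃ c ∈ S, t < c ∧
      ∃ x v, IsExtendedMotion V y c x v ∧ ∀ t ∈ Ico 0 c, x t ≠ 0 := by
    intro t
    by_cases ht : t ∈ Ico 0 b
    · obtain ⟨c, hc, htc⟩ := exists_lt_of_lt_csSup ⟨b₀, hb₀⟩ ht.2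
      obtain ⟨x, v, hm, hne⟩ := hc.2
      exact ⟨(x t, v t), fun _ => ⟨hm.isStateAt ⟨ht.1, htc⟩ (hne t ⟨ht.1, htc⟩), c, hc, htc,
        x, v, hm, hne⟩⟩
    · exact ⟨0, fun h => absurd h ht⟩
  choose w hw using hex
  have hwm : ∀ t ∈ Ico 0 b, (w t).1 ≠ 0 ∧ HasDerivWithinAt w (field V (w t)) (Ici 0) t := by
    intro t ht
    obtain ⟨hst, c, hc, htc, x, v, hm, hne⟩ := hw t ht
    have hcb : c ≤ b := le_csSup hbdd hc
    have heq : ∀ s ∈ Ico 0 c, w s = (x s, v s) := fun s hs =>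
      (hw s ⟨hs.1, hs.2.trans_le hcb⟩).1.unique hV (hm.isStateAt hs (hne s hs))
    refine ⟨hst.ne_zero, ?_⟩
    rw [heq t ⟨ht.1, htc⟩]
    refine (hm.hasDerivWithinAt ⟨ht.1, htc⟩ (hne t ⟨ht.1, htc⟩)).congr_of_eventuallyEq ?_
      (heq t ⟨ht.1, htc⟩)
    exact mem_of_superset (inter_mem self_mem_nhdsWithin (nhdsWithin_le_nhds (Iio_mem_nhds htc)))
      fun s hs => heq s hs
  have hw0 : w 0 = y := by
    obtain ⟨x, v, hm, hne⟩ := hb₀.2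
    have := (hw 0 ⟨le_rfl, hbpos⟩).1.unique hV
      (hm.isStateAt ⟨le_rfl, hb₀.1.1⟩ (hne 0 ⟨le_rfl, hb₀.1.1⟩))
    rw [this, hm.state_zero]
  have hmot := isExtendedMotion_of_classical hw0 hy hwm
  refine ⟨b, ⟨hbpos, hbB⟩, _, _, hmot, fun t ht => (hwm t ht).1, ?_⟩
  rw [or_iff_not_imp_left]
  intro hne K hK hKne t₀ ht₀
  by_contra! hcon
  have hev : ∀ᶠ t in 𝓝[<] b, w t ∈ K := by
    filter_upwards [Ioo_mem_nhdsLT (max_lt hbpos ht₀)] with t ht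
    exact hcon t ⟨(le_max_left _ _).trans ht.1.le, ht.2⟩ ((le_max_right _ _).trans_lt ht.1)
  -- Near a cluster point `z` in `K` all data share a lifespan `ε`. Restarting within `ε` before `b`
  -- would extend the solution past the supremum.
  obtain ⟨z, hz, hcl⟩ := hK (f := map w (𝓝[<] b)) (le_principal_iff.2 hev)
  obtain ⟨r, hr, ε, hε, hl⟩ := exists_local_motion hV (hKne z hz)
  have hfreq : ∃ᶠ t in 𝓝[<] b, w t ∈ Metric.ball z r :=
    (clusterPt_iff_frequently.1 hcl _ (Metric.ball_mem_nhds z hr))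
  obtain ⟨t, htz, ht⟩ := (hfreq.and_eventually
    (Ioo_mem_nhdsLT (max_lt hbpos (show b - ε < b by linarith)))).exists
  obtain ⟨x', v', hm', hs'⟩ := hl _ htz
  have ht0 : 0 < t := (le_max_left _ _).trans_lt ht.1
  have htε : b < t + ε := by linarith [(le_max_right 0 (b - ε)).trans_lt ht.1]
  have hcat := hmot.concat ⟨ht0.le, ht.2⟩ hm'
  have hmem : min (t + ε) B ∈ S := by
    refine ⟨⟨lt_min (by linarith) hB, min_le_right _ _⟩, _, _, hcat.mono (min_le_left _ _),
      fun s hs => ?_⟩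
    have hs2 := hs.2.trans_le (min_le_left _ _)
    rcases le_total s t with hst | hst
    · rw [concat_of_le _ _ hst]
      exact (hwm s ⟨hs.1, hst.trans_lt ht.2⟩).1
    · rw [concat_of_ge hm'.init_pos.symm hst]
      exact (hs' (s - t) ⟨by linarith, by linarith⟩).1
  exact absurd (le_csSup hbdd hmem) (not_le.2 (lt_min htε (lt_of_le_of_ne hbB hne)))

end Dependence

/-! ### Logarithmic growth of the potential -/

section Potential

variable {V : ℝ → ℝ} {R : ℝ}

/-- The condition `V' / V'' ≤ -r / 2` with `V'' > 0` says `2 V' + r V'' ≤ 0`, and `(r² V')' = r (2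
V' + r V'')`. -/
lemma antitoneOn_sq_mul_deriv (hV : ContDiffOn ℝ ∞ V (Ioi 0)) (hR : IsAdmissibleRadius V R) :
    AntitoneOn (fun r => r ^ 2 * deriv V r) (Ioo 0 R) := by
  have hd : ∀ r ∈ Ioo 0 R, HasDerivAt (fun r => r ^ 2 * deriv V r)
      (2 * r * deriv V r + r ^ 2 * deriv (deriv V) r) r := fun r hr => by
    have h1 : HasDerivAt (deriv V) (deriv (deriv V) r) r :=
      ((contDiffAt_deriv hV hr.1).differentiableAt (by simp)).hasDerivAt
    simpa using! (hasDerivAt_pow 2 r).mul h1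
  refine antitoneOn_of_deriv_nonpos (convex_Ioo 0 R)
    (fun r hr => (hd r hr).continuousAt.continuousWithinAt) ?_ ?_
  · rw [interior_Ioo]
    exact fun r hr => (hd r hr).differentiableAt.differentiableWithinAt
  · rw [interior_Ioo]
    intro r hr
    rw [(hd r hr).deriv]
    have h2 := hR.convex.deriv2_pos r hr
    have h3 := hR.ratio_le r hr
    rw [div_le_iff₀ h2] at h3
    nlinarith [hr.1]

/-- Monotonicity of `s² V'(s)` gives `V'(s) ≤ -A / s²` on `[r, 2r]` with `A = -r² V'(r)`;
integration yields `V(r) - V(2r) ≥ A / (2r)`. -/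
lemma neg_mul_deriv_le (hV : ContDiffOn ℝ ∞ V (Ioi 0)) (hR : IsAdmissibleRadius V R) {r : ℝ}
    (hr : 0 < r) (hrR : 2 * r < R) : -r * deriv V r ≤ 2 * (V r - V (2 * r)) := by
  set A := -(r ^ 2 * deriv V r) with hA
  have hd : ∀ s ∈ Icc r (2 * r), HasDerivAt (fun s => V s - A * s⁻¹)
      (deriv V s - A * -(s ^ 2)⁻¹) s := fun s hs =>
    (hasDerivAt_of_smooth hV (hr.trans_le hs.1)).sub
      ((hasDerivAt_inv (hr.trans_le hs.1).ne').const_mul A)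
  have hanti : AntitoneOn (fun s => V s - A * s⁻¹) (Icc r (2 * r)) := by
    refine antitoneOn_of_deriv_nonpos (convex_Icc _ _)
      (fun s hs => (hd s hs).continuousAt.continuousWithinAt)
      (fun s hs => (hd s (interior_subset hs)).differentiableAt.differentiableWithinAt) ?_
    intro s hs
    have hs' := interior_subset hs
    have hs0 : 0 < s := hr.trans_le hs'.1
    rw [(hd s hs').deriv]
    have h1 := antitoneOn_sq_mul_deriv hV hR ⟨hr, by linarith⟩
      (show s ∈ Ioo 0 R from ⟨hs0, by linarith [hs'.2]⟩) hs'.1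
    have h2 : deriv V s - A * -(s ^ 2)⁻¹ = (s ^ 2 * deriv V s + A) * (s ^ 2)⁻¹ := by
      field_simp
      ring
    rw [h2]
    exact mul_nonpos_of_nonpos_of_nonneg (by simp only at h1; linarith) (by positivity)
  have h1 := hanti ⟨le_rfl, by linarith⟩ ⟨by linarith, le_rfl⟩ (by linarith : r ≤ 2 * r)
  have h2 : A * r⁻¹ - A * (2 * r)⁻¹ = -r * deriv V r / 2 := by
    rw [hA]; field_simp; ring
  simp only at h1
  linarith

/-- Slow variation at the ratio `2` makes `V(r) - V(2r)` at most `ε V(r) / 4`, so `-r V' ≤ ε V / 2`;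
finally `V ≤ 2 (E + V)` once `V ≥ 2 |E| + 2`. -/
lemma eventually_virial_le (hV : ClassVStar V) (hR : IsAdmissibleRadius V R) (E : ℝ) {ε : ℝ}
    (hε : 0 < ε) : ∀ᶠ r in 𝓝[>] (0 : ℝ), 1 ≤ E + V r ∧ -r * deriv V r ≤ ε * (E + V r) := by
  have h1 := (Metric.tendstoUniformlyOn_iff.1 (hV.slow 2)) (ε / 4) (by linarith)
  have h2 : ∀ᶠ r in 𝓝[>] (0 : ℝ), 2 * |E| + 2 ≤ V r := hV.singular.eventually_ge_atTop _
  have h3 : ∀ᶠ r in 𝓝[>] (0 : ℝ), r ∈ Ioo 0 (R / 2) :=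
    Ioo_mem_nhdsGT (by linarith [hR.pos])
  filter_upwards [h1, h2, h3] with r hr1 hr2 hr3
  have hr1' := hr1 2 ⟨by norm_num, le_rfl⟩
  have hE := neg_abs_le E
  have hVpos : 0 < V r := by linarith [abs_nonneg E]
  rw [Real.dist_eq, abs_lt] at hr1'
  have h4 : 1 - V (r * 2) / V r < ε / 4 := hr1'.2
  have h5 : V r - V (2 * r) ≤ ε / 4 * V r := by
    rw [mul_comm r 2] at h4
    have : V (2 * r) = V (2 * r) / V r * V r := by field_simp
    nlinarith
  have h6 := neg_mul_deriv_le hV.smooth hR hr3.1 (by linarith [hr3.2])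
  refine ⟨by linarith [abs_nonneg E], ?_⟩
  nlinarith [abs_nonneg E]

/-- A radius below which, at energies at least `E`, the kinetic energy dominates the virial
`-r V'(r)`. -/
structure IsScatteringRadius (V : ℝ → ℝ) (E ρ : ℝ) : Prop where
  pos : 0 < ρ
  deriv_neg : ∀ r ∈ Ioc 0 ρ, deriv V r < 0
  energy_ge : ∀ r ∈ Ioc 0 ρ, 1 ≤ E + V r
  virial : ∀ r ∈ Ioc 0 ρ, -r * deriv V r ≤ E + V r

lemma exists_scatteringRadius (hV : ClassVStar V) (hR : IsAdmissibleRadius V R) (E : ℝ) :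
    ∃ ρ, IsScatteringRadius V E ρ := by
  have h := (eventually_virial_le hV hR E one_pos).and
    (Ioo_mem_nhdsGT hR.pos : ∀ᶠ r in 𝓝[>] (0 : ℝ), r ∈ Ioo 0 R)
  obtain ⟨ρ, hρ, hsub⟩ := mem_nhdsGT_iff_exists_Ioc_subset.1 h
  refine ⟨ρ, hρ, fun r hr => hR.convex.deriv_neg r (hsub hr).2, fun r hr => (hsub hr).1.1,
    fun r hr => ?_⟩
  simpa using (hsub hr).1.2

lemma IsScatteringRadius.mono {E E' ρ : ℝ} (h : IsScatteringRadius V E ρ) (hE : E ≤ E') :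
    IsScatteringRadius V E' ρ where
  pos := h.pos
  deriv_neg := h.deriv_neg
  energy_ge r hr := by linarith [h.energy_ge r hr]
  virial r hr := by linarith [h.virial r hr]

/-- The virial bound makes `r (E + V)` non-decreasing, hence bounded near `0`; one more factor `r`
sends it to `0`. -/
lemma tendsto_sq_mul_energy (hV : ContDiffOn ℝ ∞ V (Ioi 0)) {E ρ : ℝ}
    (h : IsScatteringRadius V E ρ) :
    Tendsto (fun r => r ^ 2 * (E + V r)) (𝓝[>] 0) (𝓝 0) := by
  have hd : ∀ r ∈ Ioc 0 ρ, HasDerivAt (fun r => r * (E + V r)) (E + V r + r * deriv V r) r :=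
    fun r hr => by
      simpa using! (hasDerivAt_id r).mul ((hasDerivAt_of_smooth hV hr.1).const_add E)
  have hmono : MonotoneOn (fun r => r * (E + V r)) (Ioc 0 ρ) := by
    refine monotoneOn_of_deriv_nonneg (convex_Ioc _ _)
      (fun s hs => (hd s hs).continuousAt.continuousWithinAt)
      (fun s hs => (hd s (interior_subset hs)).differentiableAt.differentiableWithinAt) ?_
    intro s hs
    rw [(hd s (interior_subset hs)).deriv]
    linarith [h.virial s (interior_subset hs)]
  have hlim : Tendsto (fun r : ℝ => r * (ρ * (E + V ρ))) (𝓝[>] 0) (𝓝 0) := by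
    have : Tendsto (fun r : ℝ => r * (ρ * (E + V ρ))) (𝓝 0) (𝓝 (0 * (ρ * (E + V ρ)))) :=
      (continuous_id.mul continuous_const).tendsto 0
    rw [zero_mul] at this
    exact this.mono_left nhdsWithin_le_nhds
  refine tendsto_of_tendsto_of_tendsto_of_le_of_le' tendsto_const_nhds hlim ?_ ?_
  · filter_upwards [Ioc_mem_nhdsGT h.pos] with r hr
    exact mul_nonneg (sq_nonneg r) (by linarith [h.energy_ge r hr])
  · filter_upwards [Ioc_mem_nhdsGT h.pos] with r hr
    have := hmono hr ⟨h.pos, le_rfl⟩ hr.2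
    simp only at this
    nlinarith [hr.1]

end Potential

/-! ### Conserved quantities -/

/-- The energy `|ẋ|² / 2 - V(|x|)`. -/
def energy (V : ℝ → ℝ) (y : Phase) : ℝ := ‖y.2‖ ^ 2 / 2 - V ‖y.1‖

/-- The angular momentum. -/
def ang (y : Phase) : ℝ := y.1 0 * y.2 1 - y.1 1 * y.2 0

lemma norm_sq_eq (u : Plane) : ‖u‖ ^ 2 = u 0 ^ 2 + u 1 ^ 2 := by
  rw [EuclideanSpace.norm_sq_eq, Fin.sum_univ_two, Real.norm_eq_abs, Real.norm_eq_abs, sq_abs,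
    sq_abs]

lemma inner_eq (u v : Plane) : inner ℝ u v = u 0 * v 0 + u 1 * v 1 := by
  rw [PiLp.inner_apply, Fin.sum_univ_two]
  simp [mul_comm]

/-- Lagrange's identity; with the energy it ties together radius, `x · ẋ` and angular momentum. -/
lemma inner_sq_add_ang_sq (y : Phase) :
    inner ℝ y.1 y.2 ^ 2 + ang y ^ 2 = ‖y.1‖ ^ 2 * ‖y.2‖ ^ 2 := by
  rw [norm_sq_eq, norm_sq_eq, inner_eq, ang]
  ring

/-- The part of `|v|² x` orthogonal to `v`. -/
lemma norm_orthogonal_part (y : Phase) :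
    ‖‖y.2‖ ^ 2 • y.1 - (inner ℝ y.1 y.2 : ℝ) • y.2‖ = ‖y.2‖ * |ang y| := by
  rw [← sq_eq_sq₀ (norm_nonneg _) (by positivity), mul_pow, sq_abs, norm_sq_eq, norm_sq_eq,
    inner_eq, ang]
  simp only [PiLp.sub_apply, PiLp.smul_apply, smul_eq_mul]
  ring

lemma continuous_ang : Continuous ang := by
  unfold ang
  fun_prop

section Derivatives

variable {V : ℝ → ℝ} {w : ℝ → Phase} {s : Set ℝ} {t : ℝ}

lemma hasDerivWithinAt_fst (hV : ContDiffOn ℝ ∞ V (Ioi 0)) (hne : (w t).1 ≠ 0)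
    (h : HasDerivWithinAt w (field V (w t)) s t) :
    HasDerivWithinAt (fun u => (w u).1) (w t).2 s t := by
  rw [field_eq hV hne] at h
  exact h.fst

lemma hasDerivWithinAt_snd (hV : ContDiffOn ℝ ∞ V (Ioi 0)) (hne : (w t).1 ≠ 0)
    (h : HasDerivWithinAt w (field V (w t)) s t) :
    HasDerivWithinAt (fun u => (w u).2) ((deriv V ‖(w t).1‖ / ‖(w t).1‖) • (w t).1) s t := by
  rw [field_eq hV hne] at h
  exact h.snd

lemma hasDerivWithinAt_norm_sq (hV : ContDiffOn ℝ ∞ V (Ioi 0)) (hne : (w t).1 ≠ 0)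
    (h : HasDerivWithinAt w (field V (w t)) s t) :
    HasDerivWithinAt (fun u => ‖(w u).1‖ ^ 2) (2 * inner ℝ (w t).1 (w t).2) s t := by
  exact (hasDerivWithinAt_fst hV hne h).norm_sq

lemma hasDerivWithinAt_norm (hV : ContDiffOn ℝ ∞ V (Ioi 0)) (hne : (w t).1 ≠ 0)
    (h : HasDerivWithinAt w (field V (w t)) s t) :
    HasDerivWithinAt (fun u => ‖(w u).1‖) (inner ℝ (w t).1 (w t).2 / ‖(w t).1‖) s t := by
  have hp := norm_pos_iff.2 hne
  have := (hasDerivWithinAt_norm_sq hV hne h).sqrt (by positivity)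
  simp only [Real.sqrt_sq (norm_nonneg _)] at this
  convert this using 1
  field_simp

lemma hasDerivWithinAt_inner (hV : ContDiffOn ℝ ∞ V (Ioi 0)) (hne : (w t).1 ≠ 0)
    (h : HasDerivWithinAt w (field V (w t)) s t) :
    HasDerivWithinAt (fun u => (inner ℝ (w u).1 (w u).2 : ℝ))
      (‖(w t).2‖ ^ 2 + ‖(w t).1‖ * deriv V ‖(w t).1‖) s t := by
  have hp := norm_pos_iff.2 hne
  have := (hasDerivWithinAt_fst hV hne h).inner ℝ (hasDerivWithinAt_snd hV hne h)
  refine this.congr_deriv ?_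
  simp only [inner_smul_right, real_inner_self_eq_norm_sq]
  field_simp
  ring

lemma hasDerivWithinAt_energy (hV : ContDiffOn ℝ ∞ V (Ioi 0)) (hne : (w t).1 ≠ 0)
    (h : HasDerivWithinAt w (field V (w t)) s t) :
    HasDerivWithinAt (fun u => energy V (w u)) 0 s t := by
  have hp := norm_pos_iff.2 hne
  have h1 := (hasDerivAt_of_smooth hV hp).comp_hasDerivWithinAt t (hasDerivWithinAt_norm hV hne h)
  have h2 := ((hasDerivWithinAt_snd hV hne h).norm_sq.div_const 2).sub h1
  refine h2.congr_deriv ?_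
  simp only [inner_smul_right, real_inner_comm]
  field_simp
  ring

lemma hasDerivWithinAt_ang (hV : ContDiffOn ℝ ∞ V (Ioi 0)) (hne : (w t).1 ≠ 0)
    (h : HasDerivWithinAt w (field V (w t)) s t) :
    HasDerivWithinAt (fun u => ang (w u)) 0 s t := by
  have e : ∀ {f : ℝ → Plane} {e : Plane} (i : Fin 2), HasDerivWithinAt f e s t →
      HasDerivWithinAt (fun u => f u i) (e i) s t := fun i hf =>
    (EuclideanSpace.proj (𝕜 := ℝ) i).hasFDerivAt.comp_hasDerivWithinAt t hf
  have e1 := fun i => e i (hasDerivWithinAt_fst hV hne h)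
  have e2 := fun i => e i (hasDerivWithinAt_snd hV hne h)
  refine (((e1 0).mul (e2 1)).sub ((e1 1).mul (e2 0))).congr_deriv ?_
  simp only [PiLp.smul_apply, smul_eq_mul]
  ring

end Derivatives

/-- A classical solution on a closed interval. -/
def IsArc (V : ℝ → ℝ) (w : ℝ → Phase) (a b : ℝ) : Prop :=
  ∀ t ∈ Icc a b, (w t).1 ≠ 0 ∧ HasDerivWithinAt w (field V (w t)) (Icc a b) t

lemma IsExtendedMotion.isArc {V : ℝ → ℝ} {y : Phase} {b a c : ℝ} {x v : ℝ → Plane}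
    (h : IsExtendedMotion V y b x v) (ha : 0 ≤ a) (hc : c < b) (hne : ∀ t ∈ Icc a c, x t ≠ 0) :
    IsArc V (fun t => (x t, v t)) a c := fun t ht =>
  ⟨hne t ht, (h.hasDerivWithinAt ⟨ha.trans ht.1, ht.2.trans_lt hc⟩ (hne t ht)).mono
    fun _ hs => ha.trans hs.1⟩

lemma le_of_hasDerivWithinAt_le {f g f' g' : ℝ → ℝ} {a b : ℝ} (hab : a ≤ b)
    (hf : ∀ t ∈ Icc a b, HasDerivWithinAt f (f' t) (Icc a b) t)
    (hg : ∀ t ∈ Icc a b, HasDerivWithinAt g (g' t) (Icc a b) t)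
    (h : ∀ t ∈ Icc a b, f' t ≤ g' t) : f b - f a ≤ g b - g a := by
  have hr : ∀ {f : ℝ → ℝ} {e t : ℝ}, t ∈ Ico a b → HasDerivWithinAt f e (Icc a b) t →
      HasDerivWithinAt f e (Ici t) t := fun ht hf =>
    hf.mono_of_mem_nhdsWithin (mem_of_superset (Icc_mem_nhdsGE ht.2) (Icc_subset_Icc_left ht.1))
  have := image_le_of_deriv_right_le_deriv_boundary (f := fun t => f t - f a)
    (B := fun t => g t - g a) (fun t ht => ((hf t ht).sub_const (f a)).continuousWithinAt)
    (fun t ht => (hr ht (hf t (Ico_subset_Icc_self ht))).sub_const (f a)) (by simp)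
    (fun t ht => ((hg t ht).sub_const (g a)).continuousWithinAt)
    (fun t ht => (hr ht (hg t (Ico_subset_Icc_self ht))).sub_const (g a))
    (fun t ht => h t (Ico_subset_Icc_self ht))
  exact this ⟨hab, le_rfl⟩

lemma eq_of_hasDerivWithinAt_zero {f : ℝ → ℝ} {a b : ℝ} (hab : a ≤ b)
    (hf : ∀ t ∈ Icc a b, HasDerivWithinAt f 0 (Icc a b) t) : f b = f a := by
  have h0 : ∀ t ∈ Icc a b, HasDerivWithinAt (fun _ : ℝ => (0 : ℝ)) 0 (Icc a b) t :=
    fun t _ => hasDerivWithinAt_const t _ 0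
  have h1 := le_of_hasDerivWithinAt_le hab hf h0 fun _ _ => le_rfl
  have h2 := le_of_hasDerivWithinAt_le hab h0 hf fun _ _ => le_rfl
  linarith

/-! ### Conservation laws and convexity of the squared radius along arcs -/

namespace IsArc

variable {V : ℝ → ℝ} {w : ℝ → Phase} {a b : ℝ}

lemma sub (h : IsArc V w a b) {c d : ℝ} (hc : a ≤ c) (hd : d ≤ b) : IsArc V w c d := fun t ht =>
  ⟨(h t ⟨hc.trans ht.1, ht.2.trans hd⟩).1,
    (h t ⟨hc.trans ht.1, ht.2.trans hd⟩).2.mono (Icc_subset_Icc hc hd)⟩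

lemma energy_eq (hV : ContDiffOn ℝ ∞ V (Ioi 0)) (h : IsArc V w a b) {t : ℝ} (ht : t ∈ Icc a b) :
    energy V (w t) = energy V (w a) :=
  eq_of_hasDerivWithinAt_zero ht.1 fun s hs =>
    hasDerivWithinAt_energy hV ((h.sub le_rfl ht.2) s hs).1 ((h.sub le_rfl ht.2) s hs).2

lemma ang_eq (hV : ContDiffOn ℝ ∞ V (Ioi 0)) (h : IsArc V w a b) {t : ℝ} (ht : t ∈ Icc a b) :
    ang (w t) = ang (w a) :=
  eq_of_hasDerivWithinAt_zero (f := fun t => ang (w t)) ht.1 fun s hs =>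
    hasDerivWithinAt_ang hV ((h.sub le_rfl ht.2) s hs).1 ((h.sub le_rfl ht.2) s hs).2

variable {E ρ : ℝ}

/-- The right-hand side is the derivative of `x · ẋ`. The energy bound gives `‖ẋ‖² ≥ 2 (E + V)`, of
which the virial consumes at most `E + V`, leaving at least `1`. -/
lemma one_le_deriv_inner (hρ : IsScatteringRadius V E ρ) {y : Phase} (hy : y.1 ≠ 0)
    (hyρ : ‖y.1‖ ≤ ρ) (hE : E ≤ energy V y) :
    1 ≤ ‖y.2‖ ^ 2 + ‖y.1‖ * deriv V ‖y.1‖ := by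
  have hr : ‖y.1‖ ∈ Ioc 0 ρ := ⟨norm_pos_iff.2 hy, hyρ⟩
  have h1 := hρ.energy_ge _ hr
  have h2 := hρ.virial _ hr
  rw [energy] at hE
  linarith

lemma sub_le_inner_sub (hV : ContDiffOn ℝ ∞ V (Ioi 0)) (hρ : IsScatteringRadius V E ρ)
    (h : IsArc V w a b) (hab : a ≤ b) (hr : ∀ t ∈ Icc a b, ‖(w t).1‖ ≤ ρ)
    (hE : E ≤ energy V (w a)) :
    b - a ≤ (inner ℝ (w b).1 (w b).2 : ℝ) - inner ℝ (w a).1 (w a).2 :=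
  le_of_hasDerivWithinAt_le (f := fun t => t) hab (fun t _ => hasDerivWithinAt_id t _)
    (fun t ht => hasDerivWithinAt_inner hV (h t ht).1 (h t ht).2)
    fun t ht => one_le_deriv_inner hρ (h t ht).1 (hr t ht) (by rwa [h.energy_eq hV ht])

/-- Quantitative convexity of `|x|²`: its derivative is `2 x · ẋ`, and `x · ẋ` grows at least at
unit rate. -/
lemma norm_sq_sub_ge (hV : ContDiffOn ℝ ∞ V (Ioi 0)) (hρ : IsScatteringRadius V E ρ)
    (h : IsArc V w a b) (hab : a ≤ b) (hr : ∀ t ∈ Icc a b, ‖(w t).1‖ ≤ ρ)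
    (hE : E ≤ energy V (w a)) :
    2 * inner ℝ (w a).1 (w a).2 * (b - a) + (b - a) ^ 2 ≤ ‖(w b).1‖ ^ 2 - ‖(w a).1‖ ^ 2 := by
  have hd : ∀ t ∈ Icc a b, HasDerivWithinAt
      (fun t => 2 * inner ℝ (w a).1 (w a).2 * (t - a) + (t - a) ^ 2)
      (2 * inner ℝ (w a).1 (w a).2 + 2 * (t - a)) (Icc a b) t := fun t _ => by
    have h1 : HasDerivAt (fun t : ℝ => t - a) 1 t := (hasDerivAt_id t).sub_const a
    have h2 := ((h1.const_mul (2 * (inner ℝ (w a).1 (w a).2 : ℝ))).add (h1.pow 2)).hasDerivWithinAt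
      (s := Icc a b)
    simpa using! h2
  have := le_of_hasDerivWithinAt_le hab hd
    (fun t ht => hasDerivWithinAt_norm_sq hV (h t ht).1 (h t ht).2) fun t ht => by
      have := (h.sub le_rfl ht.2).sub_le_inner_sub hV hρ ht.1
        (fun s hs => hr s ⟨hs.1, hs.2.trans ht.2⟩) hE
      linarith
  simpa using this

end IsArc

/-! ### Turning of the velocity near the centre -/

section FlyBy

variable {V : ℝ → ℝ} {E ρ : ℝ}

lemma norm_snd_sq (y : Phase) : ‖y.2‖ ^ 2 = 2 * (energy V y + V ‖y.1‖) := by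
  rw [energy]; ring

lemma IsScatteringRadius.two_le_norm_snd_sq (hρ : IsScatteringRadius V E ρ) {y : Phase}
    (hy : y.1 ≠ 0) (hyρ : ‖y.1‖ ≤ ρ) (hE : E ≤ energy V y) : 2 ≤ ‖y.2‖ ^ 2 := by
  have := hρ.energy_ge _ ⟨norm_pos_iff.2 hy, hyρ⟩
  rw [norm_snd_sq (V := V)]
  linarith

/-- The vector is the derivative of `v / ‖v‖` when `v̇ = g x`. Only the part of `g x` orthogonal to
`v` survives, and its size is governed by the angular momentum. -/
lemma norm_normalize_deriv {x v : Plane} (hv : v ≠ 0) (g : ℝ) :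
    ‖‖v‖⁻¹ • g • x + (-(inner ℝ v (g • x) / ‖v‖) / ‖v‖ ^ 2) • v‖ = |g| * |ang (x, v)| / ‖v‖ ^ 2 := by
  have hn : 0 < ‖v‖ := norm_pos_iff.2 hv
  have h1 : ‖v‖⁻¹ • g • x + (-(inner ℝ v (g • x) / ‖v‖) / ‖v‖ ^ 2) • v =
      (g * (‖v‖ ^ 3)⁻¹) • (‖v‖ ^ 2 • x - (inner ℝ x v : ℝ) • v) := by
    rw [inner_smul_right, real_inner_comm, smul_sub, smul_smul, smul_smul, smul_smul,
      sub_eq_add_neg, ← neg_smul]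
    congr 2 <;> field_simp
  have h2 := norm_orthogonal_part (x, v)
  simp only at h2
  rw [h1, norm_smul, h2, norm_mul, norm_inv, norm_pow, norm_norm, Real.norm_eq_abs]
  field_simp

/-- The direction of the velocity turns little during a fly-by of small angular momentum. -/
lemma IsArc.turning_le (hV : ContDiffOn ℝ ∞ V (Ioi 0)) (hρ : IsScatteringRadius V E ρ)
    {w : ℝ → Phase} {a b : ℝ} (h : IsArc V w a b) (hab : a ≤ b)
    (hr : ∀ t ∈ Icc a b, ‖(w t).1‖ ≤ ρ) (hE : E ≤ energy V (w a)) (hℓ : ang (w a) ≠ 0)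
    {ε κ : ℝ} (hε : 0 < ε) (hκ : 0 < κ)
    (hεκ : ∀ r ∈ Ioc 0 κ, -r * deriv V r ≤ ε * (E + V r)) :
    ‖‖(w b).2‖⁻¹ • (w b).2 - ‖(w a).2‖⁻¹ • (w a).2‖ ≤
      ε * Real.pi + |ang (w a)| / (2 * κ ^ 2) * (b - a) := by
  set ℓ := |ang (w a)| with hℓdef
  have hℓpos : 0 < ℓ := abs_pos.2 hℓ
  have hright : ∀ {F : Type} [NormedAddCommGroup F] [NormedSpace ℝ F] {f : ℝ → F} {e : F} {t : ℝ},
      t ∈ Ico a b → HasDerivWithinAt f e (Icc a b) t → HasDerivWithinAt f e (Ici t) t :=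
    fun ht hf => hf.mono_of_mem_nhdsWithin
      (mem_of_superset (Icc_mem_nhdsGE ht.2) (Icc_subset_Icc_left ht.1))
  have hEt : ∀ t ∈ Icc a b, E ≤ energy V (w t) := fun t ht => by rwa [h.energy_eq hV ht]
  have hv2 : ∀ t ∈ Icc a b, 2 ≤ ‖(w t).2‖ ^ 2 := fun t ht =>
    hρ.two_le_norm_snd_sq (h t ht).1 (hr t ht) (hEt t ht)
  have hv : ∀ t ∈ Icc a b, (w t).2 ≠ 0 := fun t ht h0 => by
    have := hv2 t ht
    rw [h0, norm_zero] at this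
    norm_num at this
  set g : ℝ → ℝ := fun t => deriv V ‖(w t).1‖ / ‖(w t).1‖
  set u' : ℝ → Plane := fun t => ‖(w t).2‖⁻¹ • g t • (w t).1 +
    (-(inner ℝ (w t).2 (g t • (w t).1) / ‖(w t).2‖) / ‖(w t).2‖ ^ 2) • (w t).2
  have hu : ∀ t ∈ Icc a b, HasDerivWithinAt (fun t => ‖(w t).2‖⁻¹ • (w t).2) (u' t) (Icc a b) t := by
    intro t ht
    have hn : 0 < ‖(w t).2‖ := norm_pos_iff.2 (hv t ht)
    have h1 := hasDerivWithinAt_snd hV (h t ht).1 (h t ht).2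
    have h2 := h1.norm_sq.sqrt (by positivity)
    simp only [Real.sqrt_sq (norm_nonneg _)] at h2
    have h3 : HasDerivWithinAt (fun t => ‖(w t).2‖) (inner ℝ (w t).2 (g t • (w t).1) / ‖(w t).2‖)
        (Icc a b) t := by
      refine h2.congr_deriv ?_
      field_simp
      rfl
    exact ((h3.fun_inv hn.ne').fun_smul h1)
  set D : ℝ → ℝ := fun t => ‖(w t).2‖ ^ 2 + ‖(w t).1‖ * deriv V ‖(w t).1‖
  -- The comparison function: `A` increases by at most `π`, independently of `ℓ`.
  set A : ℝ → ℝ := fun t => Real.arctan (inner ℝ (w t).1 (w t).2 / ℓ)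
  have hA : ∀ t ∈ Icc a b, HasDerivWithinAt A
      (1 / (1 + (inner ℝ (w t).1 (w t).2 / ℓ) ^ 2) * (D t / ℓ)) (Icc a b) t := fun t ht =>
    ((hasDerivWithinAt_inner hV (h t ht).1 (h t ht).2).div_const ℓ).arctan
  set B : ℝ → ℝ := fun t => ε * (A t - A a) + ℓ / (2 * κ ^ 2) * (t - a)
  set B' : ℝ → ℝ := fun t => ε * (1 / (1 + (inner ℝ (w t).1 (w t).2 / ℓ) ^ 2) * (D t / ℓ)) +
    ℓ / (2 * κ ^ 2)
  have hB : ∀ t ∈ Icc a b, HasDerivWithinAt B (B' t) (Icc a b) t := fun t ht => by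
    have h1 := ((hA t ht).sub_const (A a)).const_mul ε
    have h2 : HasDerivWithinAt (fun t : ℝ => ℓ / (2 * κ ^ 2) * (t - a)) (ℓ / (2 * κ ^ 2) * 1)
      (Icc a b) t := ((hasDerivWithinAt_id t _).sub_const a).const_mul _
    rw [mul_one] at h2
    exact h1.add h2
  have hbound : ∀ t ∈ Icc a b, ‖u' t‖ ≤ B' t := by
    intro t ht
    have hrpos : 0 < ‖(w t).1‖ := norm_pos_iff.2 (h t ht).1
    have hang : |ang ((w t).1, (w t).2)| = ℓ := by rw [hℓdef, ← h.ang_eq hV ht]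
    have hsq := norm_snd_sq (V := V) (w t)
    have hvir := hρ.virial _ ⟨hrpos, hr t ht⟩
    have hneg := hρ.deriv_neg _ ⟨hrpos, hr t ht⟩
    have hlag := inner_sq_add_ang_sq (w t)
    have hangsq : ang (w t) ^ 2 = ℓ ^ 2 := by rw [hℓdef, sq_abs, h.ang_eq hV ht]
    rw [hangsq] at hlag
    simp only [u', B']
    rw [norm_normalize_deriv (hv t ht), hang]
    set r := ‖(w t).1‖
    set N := ‖(w t).2‖ ^ 2
    set q := (inner ℝ (w t).1 (w t).2 : ℝ)
    have hN : 0 < N := by linarith [hv2 t ht]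
    have hEt' := hEt t ht
    have hg : |g t| = -r * deriv V r / r ^ 2 := by
      simp only [g]
      rw [abs_div, abs_of_neg hneg, abs_of_pos hrpos]
      field_simp
    -- Lagrange's identity `q² + ℓ² = r² N` puts the derivative of `A` over the same denominator as
    -- the turning rate `(-r V') ℓ / (r² N)`.
    have e1 : 1 / (1 + (q / ℓ) ^ 2) * (D t / ℓ) = ℓ * D t / (r ^ 2 * N) := by
      rw [← hlag]
      field_simp
      ring
    have hD : N / 2 ≤ D t := by
      simp only [D]
      linarith
    have e2 : ℓ / (2 * r ^ 2) ≤ ℓ * D t / (r ^ 2 * N) := by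
      rw [div_le_div_iff₀ (by positivity) (by positivity)]
      nlinarith [mul_pos hℓpos (pow_pos hrpos 2)]
    rw [e1, hg]
    have e3 : -r * deriv V r / r ^ 2 * ℓ / N = (-r * deriv V r) * (ℓ / (r ^ 2 * N)) := by
      field_simp
    rw [e3]
    have hc : 0 < ℓ / (r ^ 2 * N) := by positivity
    have e4 : ∀ c : ℝ, c * (N / 2) * (ℓ / (r ^ 2 * N)) = c * (ℓ / (2 * r ^ 2)) := fun c => by
      field_simp
    -- Inside radius `κ` the rate is at most `ε A'`. Outside, the plain virial bound gives `ℓ / (2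
    -- κ²)`, which is small with `ℓ`.
    rcases le_or_gt r κ with hrκ | hrκ
    · have h1 : -r * deriv V r ≤ ε * (N / 2) := by
        have := hεκ r ⟨hrpos, hrκ⟩
        nlinarith
      calc _ ≤ ε * (N / 2) * (ℓ / (r ^ 2 * N)) := mul_le_mul_of_nonneg_right h1 hc.le
        _ = ε * (ℓ / (2 * r ^ 2)) := e4 ε
        _ ≤ ε * (ℓ * D t / (r ^ 2 * N)) := mul_le_mul_of_nonneg_left e2 hε.le
        _ ≤ _ := le_add_of_nonneg_right (by positivity)
    · have h1 : -r * deriv V r ≤ 1 * (N / 2) := by linarith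
      calc _ ≤ 1 * (N / 2) * (ℓ / (r ^ 2 * N)) := mul_le_mul_of_nonneg_right h1 hc.le
        _ = ℓ / (2 * r ^ 2) := by rw [e4, one_mul]
        _ ≤ ℓ / (2 * κ ^ 2) := by gcongr
        _ ≤ _ := le_add_of_nonneg_left (by
          have : 0 ≤ ℓ / (2 * r ^ 2) := by positivity
          exact mul_nonneg hε.le (this.trans e2))
  have hmain := image_norm_le_of_norm_deriv_right_le_deriv_boundary'
    (f := fun t => ‖(w t).2‖⁻¹ • (w t).2 - ‖(w a).2‖⁻¹ • (w a).2) (f' := u') (B := B) (B' := B')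
    (fun t ht => ((hu t ht).sub_const _).continuousWithinAt)
    (fun t ht => (hright ht (hu t (Ico_subset_Icc_self ht))).sub_const _)
    (by simp [B]) (fun t ht => (hB t ht).continuousWithinAt)
    (fun t ht => hright ht (hB t (Ico_subset_Icc_self ht)))
    (fun t ht => hbound t (Ico_subset_Icc_self ht)) ⟨hab, le_rfl⟩
  refine hmain.trans ?_
  have h1 := Real.arctan_lt_pi_div_two (inner ℝ (w b).1 (w b).2 / ℓ)
  have h2 := Real.neg_pi_div_two_lt_arctan (inner ℝ (w a).1 (w a).2 / ℓ)
  have h3 : A b - A a ≤ Real.pi := by simp only [A]; linarith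
  simp only [B]
  linarith [mul_le_mul_of_nonneg_left h3 hε.le]

/-- States with the same energy, distance from the centre and angular momentum, but opposite
radial velocities: if their velocities are close then their positions are nearly opposite. -/
lemma norm_add_le_of_reflected {y z : Phase} (h2 : ‖z.2‖ = ‖y.2‖)
    (hq : (inner ℝ z.1 z.2 : ℝ) = -inner ℝ y.1 y.2) (hℓ : ang z = ang y) (hv : 0 < ‖y.2‖) {Δ : ℝ}
    (hΔ : ‖‖z.2‖⁻¹ • z.2 - ‖y.2‖⁻¹ • y.2‖ ≤ Δ) :
    ‖z.2 - y.2‖ ≤ ‖y.2‖ * Δ ∧ ‖z.1 + y.1‖ ≤ ‖y.1‖ * Δ + 2 * |ang y| / ‖y.2‖ := by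
  set n := ‖y.2‖
  have e1 : ‖z.2 - y.2‖ ≤ n * Δ := by
    have : z.2 - y.2 = n • (‖z.2‖⁻¹ • z.2 - n⁻¹ • y.2) := by
      rw [h2, ← smul_sub, smul_smul, mul_inv_cancel₀ hv.ne', one_smul]
    rw [this, norm_smul, Real.norm_of_nonneg hv.le]
    exact mul_le_mul_of_nonneg_left hΔ hv.le
  refine ⟨e1, ?_⟩
  have o1 := norm_orthogonal_part y
  have o2 := norm_orthogonal_part z
  rw [h2, hℓ, hq] at o2
  -- Both positions are split along and across their velocities. The transverse parts have size `n
  -- |ℓ|`; the longitudinal parts, with opposite coefficients, leave only a multiple of `z.2 - y.2`.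
  have e2 : n ^ 2 • (z.1 + y.1) = (n ^ 2 • z.1 - (-inner ℝ y.1 y.2 : ℝ) • z.2) +
      (n ^ 2 • y.1 - (inner ℝ y.1 y.2 : ℝ) • y.2) - (inner ℝ y.1 y.2 : ℝ) • (z.2 - y.2) := by
    module
  have e3 : ‖n ^ 2 • (z.1 + y.1)‖ ≤ n * |ang y| + n * |ang y| + ‖y.1‖ * n * (n * Δ) := by
    rw [e2]
    refine (norm_sub_le _ _).trans (add_le_add ((norm_add_le _ _).trans_eq (by rw [o1, o2])) ?_)
    rw [norm_smul]
    exact mul_le_mul (abs_real_inner_le_norm _ _) e1 (norm_nonneg _) (by positivity)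
  rw [norm_smul, Real.norm_of_nonneg (by positivity)] at e3
  have e4 : ‖y.1‖ * Δ + 2 * |ang y| / n =
      (n * |ang y| + n * |ang y| + ‖y.1‖ * n * (n * Δ)) / n ^ 2 := by
    field_simp
    ring
  rw [e4, le_div_iff₀ (by positivity), mul_comm]
  exact e3

/-! ### Return or collapse of inward motions -/

/-- An inward motion returns to its initial distance from the centre, or leaves all compact sets
without leaving the initial ball. -/
lemma return_or_collapse (hV : ContDiffOn ℝ ∞ V (Ioi 0)) (hρ : IsScatteringRadius V E ρ)
    {y : Phase} (hy : y.1 ≠ 0) (hyρ : ‖y.1‖ ≤ ρ) (hE : E ≤ energy V y)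
    (hin : (inner ℝ y.1 y.2 : ℝ) < 0) :
    ∃ b x v, IsExtendedMotion V y b x v ∧ (∀ t ∈ Ico 0 b, x t ≠ 0) ∧
      ((∃ t ∈ Ioc 0 (-2 * inner ℝ y.1 y.2 : ℝ), t < b ∧ (∀ s ∈ Icc 0 t, ‖x s‖ ≤ ‖y.1‖) ∧
        ‖x t‖ = ‖y.1‖) ∨
      (0 < b ∧ b ≤ -2 * inner ℝ y.1 y.2 ∧ (∀ t ∈ Ico 0 b, ‖x t‖ ≤ ‖y.1‖) ∧
        ∀ K : Set Phase, IsCompact K → (∀ z ∈ K, z.1 ≠ 0) → ∀ t₀ < b,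
          ∃ t ∈ Ico 0 b, t₀ < t ∧ (x t, v t) ∉ K)) := by
  set q := (inner ℝ y.1 y.2 : ℝ) with hq
  -- The horizon exceeds `-2q`, the longest possible stay in the initial ball, so a motion that
  -- stays inside must end before it.
  obtain ⟨b, ⟨hb0, hbB⟩, x, v, hm, hne, hmax⟩ :=
    exists_maximal_motion hV hy (B := -2 * q + 1) (by linarith)
  have htime : ∀ t ∈ Ico 0 b, (∀ s ∈ Icc 0 t, ‖x s‖ ≤ ‖y.1‖) → 2 * q * t + t ^ 2 ≤
      ‖x t‖ ^ 2 - ‖y.1‖ ^ 2 := by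
    intro t ht hs
    have harc := hm.isArc le_rfl ht.2 fun s hs => hne s ⟨hs.1, hs.2.trans_lt ht.2⟩
    have := harc.norm_sq_sub_ge hV hρ ht.1 (fun s h => (hs s h).trans hyρ)
      (by simpa only [hm.state_zero] using hE)
    simpa only [hm.init_pos, hm.init_vel, sub_zero, ← hq] using this
  refine ⟨b, x, v, hm, hne, ?_⟩
  by_cases hA : ∃ t ∈ Ico 0 b, ‖y.1‖ < ‖x t‖
  · left
    obtain ⟨t₁, ht₁, hlt⟩ := hA
    have hpos : 0 < t₁ := by
      rcases ht₁.1.eq_or_lt with h | h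
      · rw [← h, hm.init_pos] at hlt; exact absurd hlt (lt_irrefl _)
      · exact h
    have hd : HasDerivWithinAt (fun t => ‖x t‖ ^ 2) (2 * q) (Ici 0) 0 := by
      have := hasDerivWithinAt_norm_sq hV (w := fun t => (x t, v t)) (hne 0 ⟨le_rfl, hb0⟩)
        (hm.hasDerivWithinAt ⟨le_rfl, hb0⟩ (hne 0 ⟨le_rfl, hb0⟩))
      simpa only [hm.init_pos, hm.init_vel] using this
    have hev : ∀ᶠ s in 𝓝[>] (0 : ℝ), ‖x s‖ < ‖y.1‖ := by
      have h1 := hasDerivWithinAt_iff_tendsto_slope.1 hd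
      rw [Ici_sdiff_left] at h1
      filter_upwards [h1.eventually_lt_const (show 2 * q < 0 by linarith), self_mem_nhdsWithin]
        with s hs hs0
      have hs0' : 0 < s := hs0
      rw [slope_def_field, div_neg_iff] at hs
      have h2 : ‖x s‖ ^ 2 < ‖y.1‖ ^ 2 := by
        rw [hm.init_pos] at hs
        rcases hs with h | h <;> linarith
      exact lt_of_pow_lt_pow_left₀ 2 (norm_nonneg _) h2
    obtain ⟨d, hd0, hsub⟩ := mem_nhdsGT_iff_exists_Ioo_subset.1 hev
    have hd0' : 0 < d := hd0
    -- The search for the first return starts at a positive time at which the motion is strictly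
    -- inside, to avoid the trivial solution `0`.
    set t₀ := min d t₁ / 2
    have hmin : 0 < min d t₁ := lt_min hd0' hpos
    have ht₀ : 0 < t₀ := half_pos hmin
    have ht₀d : t₀ < d := (half_lt_self hmin).trans_le (min_le_left _ _)
    have ht₀₁ : t₀ < t₁ := (half_lt_self hmin).trans_le (min_le_right _ _)
    have hcont : ContinuousOn (fun t => ‖x t‖) (Icc t₀ t₁) :=
      (hm.cont.mono fun t ht => ⟨ht₀.le.trans ht.1, ht.2.trans_lt ht₁.2⟩).norm
    have hC : IsCompact (Icc t₀ t₁ ∩ (fun t => ‖x t‖) ⁻¹' Ici ‖y.1‖) :=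
      isCompact_Icc.of_isClosed_subset
        (hcont.preimage_isClosed_of_isClosed isClosed_Icc isClosed_Ici) inter_subset_left
    obtain ⟨t, ⟨ht, hty⟩, hleast⟩ := hC.exists_isLeast ⟨t₁, ⟨ht₀₁.le, le_rfl⟩, hlt.le⟩
    have hbefore : ∀ s ∈ Ioo 0 t, ‖x s‖ < ‖y.1‖ := fun s hs => by
      rcases lt_or_ge s t₀ with h | h
      · exact hsub ⟨hs.1, h.trans ht₀d⟩
      · by_contra hcon
        exact absurd (hleast ⟨⟨h, hs.2.le.trans ht.2⟩, not_lt.1 hcon⟩) (not_le.2 hs.2)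
    have heq : ‖x t‖ = ‖y.1‖ := by
      have hx0 : ‖x t₀‖ < ‖y.1‖ := hsub ⟨ht₀, ht₀d⟩
      obtain ⟨s, hs, hse⟩ := intermediate_value_Icc ht.1 (hcont.mono (Icc_subset_Icc_right ht.2))
        ⟨hx0.le, hty⟩
      have := hleast ⟨⟨hs.1, hs.2.trans ht.2⟩, hse.ge⟩
      rwa [le_antisymm hs.2 this] at hse
    have htpos : 0 < t := ht₀.trans_le ht.1
    have htb : t < b := ht.2.trans_lt ht₁.2
    have hle : ∀ s ∈ Icc 0 t, ‖x s‖ ≤ ‖y.1‖ := fun s hs => by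
      rcases hs.1.eq_or_lt with h | h
      · rw [← h, hm.init_pos]
      · rcases hs.2.eq_or_lt with h' | h'
        · rw [h', heq]
        · exact (hbefore s ⟨h, h'⟩).le
    refine ⟨t, ⟨htpos, ?_⟩, htb, hle, heq⟩
    have := htime t ⟨htpos.le, htb⟩ hle
    rw [heq, sub_self] at this
    nlinarith
  · push Not at hA
    right
    have hbound : b ≤ -2 * q := by
      -- At any time beyond `-2q` the convexity estimate would put the motion outside the ball.
      refine le_of_forall_lt fun t htb => ?_
      by_contra! hcon
      have hs : (t + b) / 2 ∈ Ico 0 b := ⟨by linarith, by linarith⟩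
      have := htime _ hs fun s hs' => hA s ⟨hs'.1, hs'.2.trans_lt hs.2⟩
      have h2 : ‖x ((t + b) / 2)‖ ^ 2 ≤ ‖y.1‖ ^ 2 :=
        pow_le_pow_left₀ (norm_nonneg _) (hA _ hs) 2
      have h3 : 0 < (t + b) / 2 * (2 * q + (t + b) / 2) :=
        mul_pos (by linarith) (by linarith)
      nlinarith
    exact ⟨hb0, hbound, hA, hmax.resolve_left (by linarith)⟩

/-- Otherwise Lagrange's identity gives `r² ‖ẋ‖² = 0`, whereas `‖ẋ‖² ≥ 2`. -/
lemma inner_ne_zero_of_ang_eq_zero (hρ : IsScatteringRadius V E ρ) {y : Phase} (hy : y.1 ≠ 0)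
    (hyρ : ‖y.1‖ ≤ ρ) (hE : E ≤ energy V y) (hℓ : ang y = 0) : (inner ℝ y.1 y.2 : ℝ) ≠ 0 := by
  intro h
  have h1 := inner_sq_add_ang_sq y
  have h2 := hρ.two_le_norm_snd_sq hy hyρ hE
  have h3 : 0 < ‖y.1‖ := norm_pos_iff.2 hy
  rw [h, hℓ] at h1
  nlinarith [pow_pos h3 2]

/-- Along a radial arc `x · ẋ` never vanishes, so by continuity it keeps its sign. -/
lemma IsArc.inner_neg (hV : ContDiffOn ℝ ∞ V (Ioi 0)) (hρ : IsScatteringRadius V E ρ)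
    {w : ℝ → Phase} {a b : ℝ} (h : IsArc V w a b) (hab : a ≤ b)
    (hr : ∀ t ∈ Icc a b, ‖(w t).1‖ ≤ ρ) (hE : E ≤ energy V (w a)) (hℓ : ang (w a) = 0)
    (hin : (inner ℝ (w a).1 (w a).2 : ℝ) < 0) : (inner ℝ (w b).1 (w b).2 : ℝ) < 0 := by
  by_contra! hcon
  obtain ⟨t, ht, h0⟩ := intermediate_value_Icc hab (f := fun t => (inner ℝ (w t).1 (w t).2 : ℝ))
    (fun t ht => (hasDerivWithinAt_inner hV (h t ht).1 (h t ht).2).continuousWithinAt)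
    ⟨hin.le, hcon⟩
  exact inner_ne_zero_of_ang_eq_zero hρ (h t ht).1 (hr t ht) (by rwa [h.energy_eq hV ht])
    (by rwa [h.ang_eq hV ht]) h0

/-- A motion that leaves all compact sets within a small ball tends to the centre. -/
lemma collapse_tendsto (hV : ContDiffOn ℝ ∞ V (Ioi 0)) (hρ : IsScatteringRadius V E ρ)
    {y : Phase} (hyρ : ‖y.1‖ ≤ ρ) (hE : E ≤ energy V y)
    (hin : (inner ℝ y.1 y.2 : ℝ) < 0) {b : ℝ} {x v : ℝ → Plane} (hm : IsExtendedMotion V y b x v)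
    (hb : 0 < b) (hne : ∀ t ∈ Ico 0 b, x t ≠ 0) (hle : ∀ t ∈ Ico 0 b, ‖x t‖ ≤ ‖y.1‖)
    (hK : ∀ K : Set Phase, IsCompact K → (∀ z ∈ K, z.1 ≠ 0) → ∀ t₀ < b,
          ∃ t ∈ Ico 0 b, t₀ < t ∧ (x t, v t) ∉ K) :
    ang y = 0 ∧ Tendsto x (𝓝[<] b) (𝓝 0) := by
  have harc : ∀ {s t : ℝ}, 0 ≤ s → t < b → IsArc V (fun t => (x t, v t)) s t := fun hs ht =>
    hm.isArc hs ht fun u hu => hne u ⟨hs.trans hu.1, hu.2.trans_lt ht⟩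
  have henergy : ∀ t ∈ Ico 0 b, energy V (x t, v t) = energy V y := fun t ht => by
    have := (harc le_rfl ht.2).energy_eq hV ⟨ht.1, le_rfl⟩
    simpa only [hm.state_zero] using this
  have hang : ∀ t ∈ Ico 0 b, ang (x t, v t) = ang y := fun t ht => by
    have := (harc le_rfl ht.2).ang_eq hV ⟨ht.1, le_rfl⟩
    simpa only [hm.state_zero] using this
  have hsmall : ∀ κ > 0, ∀ t₀ < b, ∃ t ∈ Ico 0 b, t₀ < t ∧ ‖x t‖ < κ := by
    intro κ hκ t₀ ht₀
    -- Over the annulus `κ ≤ |x| ≤ ρ` the conserved energy bounds the velocity. These states form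
    -- part of a compact set off the centre, which the motion leaves at arbitrarily late times.
    have hcV : ContinuousOn V (Icc κ ρ) := fun r hr =>
      (hasDerivAt_of_smooth hV (hκ.trans_le hr.1)).continuousAt.continuousWithinAt
    obtain ⟨C, hC⟩ := isCompact_Icc.exists_bound_of_continuousOn hcV
    have hcomp : IsCompact ((Metric.closedBall (0 : Plane) ρ \ Metric.ball 0 κ) ×ˢ
        Metric.closedBall (0 : Plane) (√(2 * (energy V y + C)))) :=
      ((isCompact_closedBall _ _).diff Metric.isOpen_ball).prod (isCompact_closedBall _ _)
    obtain ⟨t, ht, htt, hout⟩ := hK _ hcomp (fun z hz h0 => hz.1.2 (by simpa [h0] using hκ)) t₀ ht₀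
    refine ⟨t, ht, htt, ?_⟩
    by_contra! hcon
    have hrρ := (hle t ht).trans hyρ
    refine hout ⟨⟨by simpa using hrρ, by simpa using hcon⟩, ?_⟩
    rw [mem_closedBall_zero_iff]
    refine Real.le_sqrt_of_sq_le ?_
    rw [norm_snd_sq (V := V) (x t, v t), henergy t ht]
    have := (le_abs_self _).trans (hC _ ⟨hcon, hrρ⟩)
    simp only
    linarith
  -- Lagrange's identity gives `ℓ² ≤ 2 r² (E + V)`, and the right-hand side is arbitrarily small
  -- along the motion.
  have hℓ : ang y = 0 := by
    by_contra hℓ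
    have hlim := tendsto_sq_mul_energy hV (hρ.mono hE)
    have hℓ2 : 0 < ang y ^ 2 / 2 := by positivity
    obtain ⟨κ, hκ, hsub⟩ := mem_nhdsGT_iff_exists_Ioo_subset.1 (hlim.eventually_lt_const hℓ2)
    obtain ⟨t, ht, _, hlt⟩ := hsmall κ hκ 0 hb
    have h1 : ‖x t‖ ^ 2 * (energy V y + V ‖x t‖) < ang y ^ 2 / 2 :=
      hsub ⟨norm_pos_iff.2 (hne t ht), hlt⟩
    have h2 := inner_sq_add_ang_sq (x t, v t)
    rw [hang t ht, norm_snd_sq (V := V) (x t, v t), henergy t ht] at h2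
    simp only at h2
    nlinarith [sq_nonneg (inner ℝ (x t) (v t) : ℝ)]
  refine ⟨hℓ, ?_⟩
  have hneg : ∀ t ∈ Ico 0 b, (inner ℝ (x t) (v t) : ℝ) < 0 := fun t ht =>
    (harc le_rfl ht.2).inner_neg hV hρ ht.1
      (fun s hs => (hle s ⟨hs.1, hs.2.trans_lt ht.2⟩).trans hyρ)
      (by simpa only [hm.state_zero] using hE) (by simpa only [hm.state_zero] using hℓ)
      (by simpa only [hm.init_pos, hm.init_vel] using hin)
  rw [Metric.tendsto_nhds]
  intro κ hκ
  obtain ⟨t, ht, _, hlt⟩ := hsmall κ hκ 0 hb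
  -- Since `x · ẋ < 0`, the radius decreases: once below `κ` it stays there.
  filter_upwards [Ioo_mem_nhdsLT ht.2] with s hs
  rw [dist_zero_right]
  have h1 := le_of_hasDerivWithinAt_le hs.1.le
    (fun u hu => hasDerivWithinAt_norm_sq hV (harc ht.1 hs.2 u hu).1 (harc ht.1 hs.2 u hu).2)
    (fun u _ => hasDerivWithinAt_const u _ (0 : ℝ))
    fun u hu => by
      have := hneg u ⟨ht.1.trans hu.1, hu.2.trans_lt hs.2⟩
      simp only
      linarith
  simp only [sub_self, sub_nonpos] at h1
  exact ((pow_le_pow_iff_left₀ (norm_nonneg _) (norm_nonneg _) two_ne_zero).1 h1).trans_lt hlt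

end FlyBy

/-! ### Passage near the centre -/

section Passage

variable {V : ℝ → ℝ} {E ρ : ℝ}

/-- A motion that ends in a collision is continued by reflection. -/
lemma IsExtendedMotion.reflect (hV : ContDiffOn ℝ ∞ V (Ioi 0)) {y : Phase} {b : ℝ}
    {x v : ℝ → Plane} (hm : IsExtendedMotion V y b x v) (hb : 0 < b)
    (hne : ∀ t ∈ Ico 0 b, x t ≠ 0) (hlim : Tendsto x (𝓝[<] b) (𝓝 0)) :
    ∃ X W, IsExtendedMotion V y (2 * b) X W ∧
      ∀ t ∈ Ioo b (2 * b), X t = -x (2 * b - t) ∧ W t = v (2 * b - t) := by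
  set X : ℝ → Plane := fun t => if t < b then x t else if t = b then 0 else -x (2 * b - t)
  -- Two sign changes cancel: the velocity of `t ↦ -x (2b - t)` is `v (2b - t)`. The value at `b` is
  -- immaterial.
  set W : ℝ → Plane := fun t => if t < b then v t else v (2 * b - t)
  have hXl : ∀ t < b, X t = x t := fun t ht => if_pos ht
  have hWl : ∀ t < b, W t = v t := fun t ht => if_pos ht
  have hXb : X b = 0 := by simp [X]
  have hXr : ∀ t > b, X t = -x (2 * b - t) := fun t ht => by
    simp only [X]
    rw [if_neg (not_lt.2 ht.le), if_neg ht.ne']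
  have hWr : ∀ t > b, W t = v (2 * b - t) := fun t ht => if_neg (not_lt.2 ht.le)
  have hsol : ∀ t ∈ Ioo b (2 * b), SolvesAt V X W t := by
    intro t ht
    have hmem : 2 * b - t ∈ Ioo 0 b := ⟨by linarith [ht.2], by linarith [ht.1]⟩
    have hne' := hne (2 * b - t) ⟨hmem.1.le, hmem.2⟩
    have hd := hm.hasDerivAt hmem hne'
    have hx : HasDerivAt x (v (2 * b - t)) (2 * b - t) := by
      simpa using! (hasDerivWithinAt_fst hV (w := fun t => (x t, v t)) hne'
        (hd.hasDerivWithinAt (s := univ))).hasDerivAt univ_mem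
    have hv := (hasDerivWithinAt_snd hV (w := fun t => (x t, v t)) hne'
        (hd.hasDerivWithinAt (s := univ))).hasDerivAt univ_mem
    simp only at hv
    have hr : HasDerivAt (fun s => 2 * b - s) (-1) t := by
      simpa using (hasDerivAt_id t).const_sub (2 * b)
    have hX : HasDerivAt X (v (2 * b - t)) t := by
      have h1 : HasDerivAt (fun s => -x (2 * b - s)) (v (2 * b - t)) t := by
        simpa using! (hx.scomp t hr).neg
      exact h1.congr_of_eventuallyEq (mem_of_superset (Ioi_mem_nhds ht.1) fun s hs => hXr s hs)
    have hW : HasDerivAt W ((deriv V ‖X t‖ / ‖X t‖) • X t) t := by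
      have h1 : HasDerivAt (fun s => v (2 * b - s)) ((deriv V ‖X t‖ / ‖X t‖) • X t) t := by
        have := hv.scomp t hr
        rw [hXr t ht.1]
        simpa [Function.comp_def] using! this
      exact h1.congr_of_eventuallyEq (mem_of_superset (Ioi_mem_nhds ht.1) fun s hs => hWr s hs)
    have hXne : (X t, W t).1 ≠ 0 := by simpa [hXr t ht.1] using hne'
    rw [SolvesAt, field_eq hV hXne]
    refine ⟨?_, hW.hasDerivWithinAt⟩
    simpa only [hWr t ht.1] using hX.hasDerivWithinAt
  have hsoll : ∀ t ∈ Ico 0 b, SolvesAt V X W t := by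
    intro t ht
    have h1 := hm.solves t ht (hne t ht)
    rw [SolvesAt, hXl t ht.2, hWl t ht.2]
    have hnear : Iio b ∈ 𝓝[Ici 0] t := nhdsWithin_le_nhds (Iio_mem_nhds ht.2)
    exact ⟨h1.1.congr_of_eventuallyEq (mem_of_superset hnear hXl) (hXl t ht.2),
      h1.2.congr_of_eventuallyEq (mem_of_superset hnear hWl) (hWl t ht.2)⟩
  have hcb : ContinuousAt X b := by
    rw [continuousAt_iff_continuous_left'_right', ContinuousWithinAt, ContinuousWithinAt, hXb]
    refine ⟨hlim.congr' (eventually_mem_nhdsWithin.mono fun t ht => (hXl t ht).symm), ?_⟩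
    have h1 : Tendsto (fun t => 2 * b - t) (𝓝[>] b) (𝓝[<] b) := by
      refine tendsto_nhdsWithin_iff.2 ⟨?_, eventually_mem_nhdsWithin.mono fun t ht => ?_⟩
      · have : Tendsto (fun t => 2 * b - t) (𝓝 b) (𝓝 (2 * b - b)) :=
          (continuous_const.sub continuous_id).tendsto b
        rw [show 2 * b - b = b by ring] at this
        exact this.mono_left nhdsWithin_le_nhds
      · have ht' : b < t := ht
        exact show 2 * b - t < b by linarith
    have h2 := (hlim.comp h1).neg
    rw [neg_zero] at h2
    exact h2.congr' (eventually_mem_nhdsWithin.mono fun t ht => (hXr t ht).symm)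
  refine ⟨X, W, ⟨hm.ne_zero, by rw [hXl 0 hb, hm.init_pos], by rw [hWl 0 hb, hm.init_vel],
    fun t ht => ?_, fun t ht hx => ?_, fun c hc hx => ?_⟩, fun t ht => ⟨hXr t ht.1, hWr t ht.1⟩⟩
  · rcases lt_trichotomy t b with h | h | h
    · exact (hsoll t ⟨ht.1, h⟩).1.continuousWithinAt.mono Ico_subset_Ici_self
    · rw [h]
      exact hcb.continuousWithinAt
    · exact (hsol t ⟨h, ht.2⟩).1.continuousWithinAt.mono Ico_subset_Ici_self
  · rcases lt_trichotomy t b with h | h | h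
    · exact hsoll t ⟨ht.1, h⟩
    · exact absurd (h ▸ hXb) hx
    · exact hsol t ⟨h, ht.2⟩
  · rcases lt_trichotomy c b with h | h | h
    · rw [hXl c h] at hx
      exact absurd hx (hne c ⟨hc.1.le, h⟩)
    · subst h
      refine ⟨c, hb, fun s hs => ?_⟩
      rw [hXr _ (by linarith [hs.1]), hXl _ (by linarith [hs.1])]
      congr 2
      ring
    · rw [hXr c h, neg_eq_zero] at hx
      exact absurd hx (hne _ ⟨by linarith [hc.2], by linarith⟩)

/-- Radial inward motions collide and come out antipodally. -/
lemma passage_of_ang_eq_zero (hV : ContDiffOn ℝ ∞ V (Ioi 0)) (hρ : IsScatteringRadius V E ρ)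
    {y : Phase} (hy : y.1 ≠ 0) (hyρ : ‖y.1‖ ≤ ρ) (hE : E ≤ energy V y)
    (hin : (inner ℝ y.1 y.2 : ℝ) < 0) (hℓ : ang y = 0) {U : Set Phase} (hU : U ∈ 𝓝 (-y.1, y.2)) :
    ∃ t ∈ Icc 0 (-4 * inner ℝ y.1 y.2 : ℝ), ∃ z ∈ U, IsStateAt V y t z := by
  obtain ⟨b, x, v, hm, hne, ⟨t, ht, htb, hle, heq⟩ | ⟨hb, hb2, hle, hK⟩⟩ :=
    return_or_collapse hV hρ hy hyρ hE hin
  -- On a return to the initial radius, energy and angular momentum would give the same `(x · ẋ)²`.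
  -- Yet `x · ẋ` has strictly increased while remaining negative.
  · exfalso
    have harc := hm.isArc le_rfl htb fun s hs => hne s ⟨hs.1, hs.2.trans_lt htb⟩
    have hneg := harc.inner_neg hV hρ ht.1.le (fun s hs => (hle s hs).trans hyρ)
      (by simpa only [hm.state_zero] using hE) (by simpa only [hm.state_zero] using hℓ)
      (by simpa only [hm.init_pos, hm.init_vel] using hin)
    have hstrict := harc.sub_le_inner_sub hV hρ ht.1.le (fun s hs => (hle s hs).trans hyρ)
      (by simpa only [hm.state_zero] using hE)
    have henergy := harc.energy_eq hV ⟨ht.1.le, le_rfl⟩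
    have hang := harc.ang_eq hV ⟨ht.1.le, le_rfl⟩
    simp only [hm.state_zero] at henergy hang
    simp only [hm.init_pos, hm.init_vel] at hstrict hneg
    have h1 := inner_sq_add_ang_sq (x t, v t)
    rw [hang, norm_snd_sq (V := V) (x t, v t), henergy] at h1
    have h2 := inner_sq_add_ang_sq y
    rw [norm_snd_sq (V := V) y] at h2
    simp only [heq] at h1
    nlinarith [ht.1]
  · obtain ⟨_, hlim⟩ := collapse_tendsto hV hρ hyρ hE hin hm hb hne hle hK
    obtain ⟨X, W, hX, hXW⟩ := hm.reflect hV hb hne hlim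
    have hc : Tendsto (fun s => (-x s, v s)) (𝓝[>] 0) (𝓝 (-y.1, y.2)) := by
      have := (hm.continuousWithinAt_state ⟨le_rfl, hb⟩ (hne 0 ⟨le_rfl, hb⟩)).tendsto
      rw [hm.state_zero] at this
      have h2 : Continuous fun p : Phase => ((-p.1, p.2) : Phase) := by fun_prop
      exact ((h2.tendsto y).comp this).mono_left (nhdsWithin_mono _ Ioi_subset_Ici_self)
    -- The reflected motion is defined only before `2b`, so the antipodal state is approached at
    -- times `2b - s`.
    obtain ⟨s, hsU, hs⟩ := ((hc.eventually hU).and (Ioo_mem_nhdsGT hb)).exists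
    have hmem : 2 * b - s ∈ Ioo b (2 * b) := ⟨by linarith [hs.2], by linarith [hs.1]⟩
    obtain ⟨e1, e2⟩ := hXW _ hmem
    rw [sub_sub_cancel] at e1 e2
    have hst := hX.isStateAt ⟨hb.le.trans hmem.1.le, hmem.2⟩
      (by rw [e1]; exact neg_ne_zero.2 (hne s ⟨hs.1.le, hs.2⟩))
    rw [e1, e2] at hst
    exact ⟨2 * b - s, ⟨by linarith [hs.2], by linarith [hs.1]⟩, _, hsU, hst⟩

/-- Inward motions with angular momentum return to their initial distance from the centre, with
nearly the initial velocity. -/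
lemma passage_of_ang_ne_zero (hV : ContDiffOn ℝ ∞ V (Ioi 0)) (hρ : IsScatteringRadius V E ρ)
    {y : Phase} (hy : y.1 ≠ 0) (hyρ : ‖y.1‖ ≤ ρ) (hE : E ≤ energy V y)
    (hin : (inner ℝ y.1 y.2 : ℝ) < 0) (hℓ : ang y ≠ 0) {ε κ : ℝ} (hε : 0 < ε) (hκ : 0 < κ)
    (hεκ : ∀ r ∈ Ioc 0 κ, -r * deriv V r ≤ ε * (E + V r)) :
    ∃ t ∈ Icc 0 (-2 * inner ℝ y.1 y.2 : ℝ), ∃ z, IsStateAt V y t z ∧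
      ‖z.2 - y.2‖ ≤
        ‖y.2‖ * (ε * Real.pi + |ang y| / (2 * κ ^ 2) * (-2 * inner ℝ y.1 y.2)) ∧
      ‖z.1 + y.1‖ ≤ ‖y.1‖ * (ε * Real.pi + |ang y| / (2 * κ ^ 2) * (-2 * inner ℝ y.1 y.2)) +
        2 * |ang y| / ‖y.2‖ := by
  obtain ⟨b, x, v, hm, hne, ⟨t, ht, htb, hle, heq⟩ | ⟨hb, hb2, hle, hK⟩⟩ :=
    return_or_collapse hV hρ hy hyρ hE hin
  · have harc := hm.isArc le_rfl htb fun s hs => hne s ⟨hs.1, hs.2.trans_lt htb⟩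
    have hleρ : ∀ s ∈ Icc 0 t, ‖x s‖ ≤ ρ := fun s hs => (hle s hs).trans hyρ
    have hE0 : E ≤ energy V (x 0, v 0) := by rwa [hm.state_zero]
    have hstrict := harc.sub_le_inner_sub hV hρ ht.1.le hleρ hE0
    have hturn := harc.turning_le hV hρ ht.1.le hleρ hE0 (by rwa [hm.state_zero]) hε hκ hεκ
    have henergy := harc.energy_eq hV ⟨ht.1.le, le_rfl⟩
    have hang := harc.ang_eq hV ⟨ht.1.le, le_rfl⟩
    simp only [hm.state_zero] at henergy hang hturn
    simp only [hm.init_pos, hm.init_vel] at hstrict hturn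
    have hn2 : ‖v t‖ ^ 2 = ‖y.2‖ ^ 2 := by
      have h1 := norm_snd_sq (V := V) (x t, v t)
      have h2 := norm_snd_sq (V := V) y
      simp only at h1
      rw [h1, h2, henergy, heq]
    have hn : ‖v t‖ = ‖y.2‖ :=
      (pow_left_inj₀ (norm_nonneg _) (norm_nonneg _) two_ne_zero).1 hn2
    have hq : (inner ℝ (x t) (v t) : ℝ) = -inner ℝ y.1 y.2 := by
      have h1 := inner_sq_add_ang_sq (x t, v t)
      have h2 := inner_sq_add_ang_sq y
      simp only at h1
      rw [hang, heq, hn2, ← h2] at h1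
      -- The squares agree by conservation; since `x · ẋ` strictly increases, the sign is reversed.
      rcases sq_eq_sq_iff_eq_or_eq_neg.1 (add_right_cancel h1) with h | h
      · linarith [ht.1]
      · exact h
    have hv : 0 < ‖y.2‖ := by
      rw [norm_pos_iff]
      intro h0
      rw [h0, inner_zero_right] at hin
      exact lt_irrefl _ hin
    obtain ⟨e1, e2⟩ := norm_add_le_of_reflected (z := (x t, v t)) hn hq hang hv
      (hturn.trans (add_le_add_right (mul_le_mul_of_nonneg_left
        (show t - 0 ≤ -2 * inner ℝ y.1 y.2 by linarith [ht.2]) (by positivity)) _))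
    exact ⟨t, ⟨ht.1.le, ht.2⟩, _, hm.isStateAt ⟨ht.1.le, htb⟩ (hne t ⟨ht.1.le, htb⟩), e1, e2⟩
  · exact absurd (collapse_tendsto hV hρ hyρ hE hin hm hb hne hle hK).1 hℓ

lemma continuousAt_energy (hV : ContDiffOn ℝ ∞ V (Ioi 0)) {z : Phase} (hz : z.1 ≠ 0) :
    ContinuousAt (energy V) z := by
  have h1 : ContinuousAt (fun y : Phase => V ‖y.1‖) z :=
    ContinuousAt.comp (g := V) (hasDerivAt_of_smooth hV (norm_pos_iff.2 hz)).continuousAt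
      (continuous_fst.norm.continuousAt)
  exact (((continuous_snd.norm.pow 2).div_const 2).continuousAt).sub h1

/-- Data near a radial inward one pass the centre in a short time and come out nearly
antipodally. -/
lemma eventually_passage (hV : ContDiffOn ℝ ∞ V (Ioi 0)) (hρ : IsScatteringRadius V E ρ)
    (hlog : ∀ ε > 0, ∃ κ > 0, ∀ r ∈ Ioc 0 κ, -r * deriv V r ≤ ε * (E + V r))
    {z : Phase} (hz : z.1 ≠ 0) (hzρ : ‖z.1‖ < ρ) (hE : E < energy V z)
    (hin : (inner ℝ z.1 z.2 : ℝ) < 0) (hℓ : ang z = 0) {U : Set Phase} (hU : U ∈ 𝓝 (-z.1, z.2)) :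
    ∀ᶠ y in 𝓝 z, ∃ t ∈ Icc 0 (-5 * inner ℝ z.1 z.2 : ℝ), ∃ z' ∈ U, IsStateAt V y t z' := by
  obtain ⟨δ, hδ, hball⟩ := Metric.mem_nhds_iff.1 hU
  have hv : ‖z.2‖ ≠ 0 := fun h0 => by
    rw [norm_eq_zero.1 h0, inner_zero_right] at hin
    exact lt_irrefl _ hin
  have hpi := Real.pi_pos
  -- First `ε` is chosen so that the turning term is below `δ / 2`, then `κ` from `ε`. The remaining
  -- terms of `G` vanish at `z` because `ang z = 0`, so continuity makes them small nearby.
  set ε := δ / (2 * (‖z.1‖ + ‖z.2‖ + 1) * Real.pi) with hεdef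
  have hε : 0 < ε := by positivity
  obtain ⟨κ, hκ, hεκ⟩ := hlog ε hε
  have hcin : Continuous fun y : Phase => (inner ℝ y.1 y.2 : ℝ) :=
    continuous_fst.inner continuous_snd
  set G : Phase → ℝ := fun y =>
    (‖y.1‖ + ‖y.2‖) * (ε * Real.pi + |ang y| / (2 * κ ^ 2) * (-2 * inner ℝ y.1 y.2)) +
      2 * |ang y| / ‖y.2‖ + ‖y - z‖ with hG
  have hGc : ContinuousAt G z := by
    have h1 : Continuous fun y : Phase => |ang y| := continuous_ang.abs
    refine (ContinuousAt.add ?_ ?_).add ?_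
    · exact ((continuous_fst.norm.add continuous_snd.norm).mul (continuous_const.add
        ((h1.div_const _).mul (continuous_const.mul hcin)))).continuousAt
    · exact (continuous_const.mul h1).continuousAt.div continuous_snd.norm.continuousAt hv
    · exact (continuous_id.sub continuous_const).norm.continuousAt
  have hGz : G z < δ := by
    have h1 : G z = (‖z.1‖ + ‖z.2‖) * (ε * Real.pi) := by simp [hG, hℓ]
    have h2 : (‖z.1‖ + ‖z.2‖ + 1) * (ε * Real.pi) = δ / 2 := by
      rw [hεdef]; field_simp
    rw [h1]
    nlinarith [mul_pos hε hpi]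
  have hrefl : ∀ᶠ y : Phase in 𝓝 z, ((-y.1, y.2) : Phase) ∈ Metric.ball ((-z.1, z.2) : Phase) δ := by
    have h2 : Continuous fun p : Phase => ((-p.1, p.2) : Phase) := by fun_prop
    exact (h2.tendsto z).eventually (Metric.ball_mem_nhds _ hδ)
  -- The factor `5 / 4` converts the bound `-4 x · ẋ` at the nearby datum into `-5 x · ẋ` at `z`.
  filter_upwards [hGc.eventually_lt_const hGz, hrefl,
    (continuousAt_energy hV hz).eventually_const_lt hE,
    (continuous_fst.norm.tendsto z).eventually_lt_const hzρ,
    continuousAt_fst.eventually_ne hz, (hcin.tendsto z).eventually_lt_const hin,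
    (hcin.tendsto z).eventually_const_lt (show 5 / 4 * (inner ℝ z.1 z.2 : ℝ) < inner ℝ z.1 z.2
      by linarith)] with y h1 h2 h3 h4 h5 h6 h7
  by_cases hy : ang y = 0
  · obtain ⟨t, ht, z', hz', hst⟩ := passage_of_ang_eq_zero hV hρ h5 h4.le h3.le h6 hy
      (Metric.isOpen_ball.mem_nhds h2)
    exact ⟨t, ⟨ht.1, by linarith [ht.2]⟩, z', hball hz', hst⟩
  · obtain ⟨t, ht, z', hst, e1, e2⟩ :=
      passage_of_ang_ne_zero hV hρ h5 h4.le h3.le h6 hy hε hκ hεκ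
    refine ⟨t, ⟨ht.1, by linarith [ht.2]⟩, z', hball ?_, hst⟩
    set Δ := ε * Real.pi + |ang y| / (2 * κ ^ 2) * (-2 * inner ℝ y.1 y.2)
    have hΔ : 0 ≤ Δ := add_nonneg (by positivity)
      (mul_nonneg (by positivity) (by linarith))
    have hz1 : ‖y.1 - z.1‖ ≤ ‖y - z‖ := norm_fst_le (y - z)
    have hz2 : ‖y.2 - z.2‖ ≤ ‖y - z‖ := norm_snd_le (y - z)
    have p1 : 0 ≤ ‖y.1‖ * Δ := by positivity
    have p2 : 0 ≤ ‖y.2‖ * Δ := by positivity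
    have p3 : 0 ≤ 2 * |ang y| / ‖y.2‖ := by positivity
    simp only [hG] at h1
    rw [Metric.mem_ball, Prod.dist_eq, max_lt_iff, dist_eq_norm, dist_eq_norm]
    constructor
    · have h8 : z'.1 - -z.1 = (z'.1 + y.1) - (y.1 - z.1) := by abel
      simp only [h8]
      refine (norm_sub_le _ _).trans_lt ?_
      linarith
    · have h8 : z'.2 - z.2 = (z'.2 - y.2) + (y.2 - z.2) := by abel
      simp only [h8]
      refine (norm_add_le _ _).trans_lt ?_
      linarith

end Passage

/-! ### Continuous dependence through collisions -/

namespace IsExtendedMotion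

variable {V : ℝ → ℝ} {y : Phase} {b : ℝ} {x v : ℝ → Plane}

lemma pos_of_eq_zero (h : IsExtendedMotion V y b x v) {c : ℝ} (hc : 0 ≤ c) (hx : x c = 0) :
    0 < c := by
  rcases hc.eq_or_lt with h0 | h0
  · rw [← h0, h.init_pos] at hx
    exact absurd hx h.ne_zero
  · exact h0

/-- An extended motion does not rest at the centre. -/
lemma not_eq_zero_on_Icc (h : IsExtendedMotion V y b x v) {a c : ℝ} (ha : 0 ≤ a) (hac : a < c)
    (hcb : c < b) : ∃ t ∈ Icc a c, x t ≠ 0 := by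
  by_contra! hz
  have hcont : ∀ t ∈ Icc 0 c, ContinuousWithinAt (fun s => x (c - s)) (Icc 0 c) t := fun t ht =>
    (h.cont (c - t) ⟨by linarith [ht.2], by linarith [ht.1]⟩).comp
      (continuous_const.sub continuous_id).continuousWithinAt
      fun s hs => ⟨by simpa using hs.2, by simpa using by linarith [hs.1]⟩
  -- Induction in reversed time: at a zero, transmission carries the zeros just after it to the
  -- times just before it. The zero set thus spreads back to time `0`, against `ne_zero`.
  have key := real_induction (b := c + 1) (P := fun t => t ≤ c → x (c - t) = 0)
    (fun _ => by simpa using hz c ⟨hac.le, le_rfl⟩)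
    (fun t ht hP htc => by
      have hsub : Ico 0 t ⊆ Icc 0 c := fun s hs => ⟨hs.1, hs.2.le.trans htc⟩
      have hcl : t ∈ closure (Ico 0 t) := by
        rw [closure_Ico ht.1.ne]; exact ⟨ht.1.le, le_rfl⟩
      have : (𝓝[Ico 0 t] t).NeBot := mem_closure_iff_nhdsWithin_neBot.1 hcl
      have h1 : Tendsto (fun s => x (c - s)) (𝓝[Ico 0 t] t) (𝓝 (x (c - t))) :=
        (hcont t ⟨ht.1.le, htc⟩).mono hsub
      exact tendsto_nhds_unique_of_eventuallyEq h1 tendsto_const_nhds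
        (eventually_mem_nhdsWithin.mono fun s hs => hP s hs (hs.2.le.trans htc)))
    (fun t ht hP => by
      rcases lt_or_ge t (c - a) with hta | hta
      · exact ⟨c - a - t, by linarith, fun u hu _ _ =>
          hz _ ⟨by linarith [hu.2], by linarith [ht.1, hu.1]⟩⟩
      rcases lt_or_ge t c with htc | htc
      · have ht0 : 0 < t := by linarith
        obtain ⟨η, hη, hr⟩ := h.transmission (c - t) ⟨by linarith, by linarith⟩
          (hP t ⟨ht0.le, le_rfl⟩ htc.le)
        refine ⟨min η t, lt_min hη ht0, fun u hu _ _ => ?_⟩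
        have m1 := min_le_left η t
        have m2 := min_le_right η t
        have h1 := hr (u - t) ⟨by linarith [hu.1], by linarith [hu.2]⟩
        have h2 := hP (t - (u - t)) ⟨by linarith [hu.2], by linarith [hu.1]⟩ (by linarith [hu.1])
        rw [show c - t + (u - t) = c - (t - (u - t)) by ring, h2,
          show c - t - (u - t) = c - u by ring] at h1
        exact neg_eq_zero.1 h1.symm
      · exact ⟨1, one_pos, fun u hu _ huc => absurd huc (not_le.2 (htc.trans_lt hu.1))⟩)
  have := key c ⟨by linarith, by linarith⟩ le_rfl
  rw [sub_self, h.init_pos] at this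
  exact h.ne_zero this

/-- Collision instants are isolated from the left, when the energy is bounded below. -/
lemma exists_forall_ne_zero_left (hV : ContDiffOn ℝ ∞ V (Ioi 0)) {E ρ : ℝ}
    (hρ : IsScatteringRadius V E ρ) (h : IsExtendedMotion V y b x v) {c : ℝ} (hc : c ∈ Ioo 0 b)
    (hx : x c = 0) (hE : ∀ t ∈ Ico 0 c, x t ≠ 0 → E ≤ energy V (x t, v t)) :
    ∃ d ∈ Ico 0 c, ∀ t ∈ Ico d c, x t ≠ 0 ∧ ‖x t‖ < ρ := by
  have hcc : ContinuousAt x c :=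
    (h.cont c ⟨hc.1.le, hc.2⟩).continuousAt (Ico_mem_nhds hc.1 hc.2)
  have hsmall : ∀ᶠ t in 𝓝[<] c, ‖x t‖ < ρ := by
    have : Tendsto (fun t => ‖x t‖) (𝓝 c) (𝓝 ‖x c‖) := hcc.norm
    rw [hx, norm_zero] at this
    exact (this.mono_left nhdsWithin_le_nhds).eventually_lt_const hρ.pos
  obtain ⟨d₀, hd₀, hsub⟩ := mem_nhdsLT_iff_exists_Ico_subset.1
    (hsmall.and (Ioo_mem_nhdsLT hc.1))
  have hd₀' : d₀ < c := hd₀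
  have hd₀0 : 0 < d₀ := (hsub ⟨le_rfl, hd₀'⟩).2.1
  by_cases hzero : ∃ a ∈ Ico d₀ c, x a = 0
  · exfalso
    obtain ⟨a, ha, hxa⟩ := hzero
    have ha0 : 0 < a := hd₀0.trans_le ha.1
    obtain ⟨m, hm, hxm⟩ := h.not_eq_zero_on_Icc ha0.le ha.2 hc.2
    have hcont : ContinuousOn (fun t => ‖x t‖ ^ 2) (Icc a c) :=
      ((h.cont.mono fun t ht => ⟨ha0.le.trans ht.1, ht.2.trans_lt hc.2⟩).norm).pow 2
    -- Between two zeros `|x|²` has an interior maximum with zero derivative, but convexity makes it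
    -- increase strictly afterwards.
    obtain ⟨p, hp, hmax⟩ := isCompact_Icc.exists_isMaxOn ⟨m, hm⟩ hcont
    have hpm : 0 < ‖x p‖ ^ 2 :=
      lt_of_lt_of_le (pow_pos (norm_pos_iff.2 hxm) 2) (hmax hm)
    have hxp : x p ≠ 0 := fun h0 => by simp [h0] at hpm
    have hpa : a < p := lt_of_le_of_ne hp.1 fun h0 => hxp (h0 ▸ hxa)
    have hpc : p < c := lt_of_le_of_ne hp.2 fun h0 => hxp (h0 ▸ hx)
    have hpb : p ∈ Ioo 0 b := ⟨ha0.trans hpa, hpc.trans hc.2⟩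
    have hder : HasDerivAt (fun t => ‖x t‖ ^ 2) (2 * inner ℝ (x p) (v p)) p :=
      (hasDerivWithinAt_norm_sq hV (w := fun t => (x t, v t)) hxp
        ((h.hasDerivAt hpb hxp).hasDerivWithinAt (s := univ))).hasDerivAt univ_mem
    have hloc : IsLocalMax (fun t => ‖x t‖ ^ 2) p := hmax.isLocalMax (Icc_mem_nhds hpa hpc)
    have hin := hloc.hasDerivAt_eq_zero hder
    have hcp : ContinuousAt x p :=
      (h.cont p ⟨hpb.1.le, hpb.2⟩).continuousAt (Ico_mem_nhds hpb.1 hpb.2)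
    obtain ⟨q, hq, hqsub⟩ := mem_nhdsGE_iff_exists_Icc_subset.1
      (nhdsWithin_le_nhds (s := Ici p) ((hcp.eventually_ne hxp).and (Iio_mem_nhds hpc)))
    have hq' : p < q := hq
    have hqc : q < c := (hqsub ⟨hq'.le, le_rfl⟩).2
    have harc := h.isArc hpb.1.le (hqc.trans hc.2) fun t ht => (hqsub ht).1
    have := harc.norm_sq_sub_ge hV hρ hq'.le
      (fun t ht => (hsub ⟨ha.1.trans (hpa.le.trans ht.1), ht.2.trans_lt hqc⟩).1.le)
      (hE p ⟨hpb.1.le, hpc⟩ hxp)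
    simp only [hin, zero_mul, zero_add] at this
    have h2 : ‖x q‖ ^ 2 ≤ ‖x p‖ ^ 2 := hmax ⟨hpa.le.trans hq'.le, hqc.le⟩
    nlinarith [pow_pos (sub_pos.2 hq') 2]
  · push Not at hzero
    exact ⟨d₀, ⟨hd₀0.le, hd₀'⟩, fun t ht => ⟨hzero t ht, (hsub ht).1⟩⟩

/-- Motions that collide are radial and move inwards, with small `x · ẋ`, just before the
collision. -/
lemma before_collision (hV : ContDiffOn ℝ ∞ V (Ioi 0)) {E ρ : ℝ} (hρ : IsScatteringRadius V E ρ)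
    (h : IsExtendedMotion V y b x v) {c d : ℝ} (hd : d ∈ Ico 0 c) (hcb : c < b) (hx : x c = 0)
    (hne : ∀ t ∈ Ico d c, x t ≠ 0 ∧ ‖x t‖ < ρ) (hE : E ≤ energy V (x d, v d)) :
    ang (x d, v d) = 0 ∧ (∀ t ∈ Ico d c, (inner ℝ (x t) (v t) : ℝ) < 0) ∧
      Tendsto (fun t => (inner ℝ (x t) (v t) : ℝ)) (𝓝[<] c) (𝓝 0) := by
  have hc0 : 0 < c := hd.1.trans_lt hd.2
  have harc : ∀ {s t : ℝ}, d ≤ s → t < c → IsArc V (fun t => (x t, v t)) s t := fun hs ht =>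
    h.isArc (hd.1.trans hs) (ht.trans hcb) fun u hu => (hne u ⟨hs.trans hu.1, hu.2.trans_lt ht⟩).1
  have henergy : ∀ t ∈ Ico d c, energy V (x t, v t) = energy V (x d, v d) := fun t ht =>
    (harc le_rfl ht.2).energy_eq hV ⟨ht.1, le_rfl⟩
  have hang : ∀ t ∈ Ico d c, ang (x t, v t) = ang (x d, v d) := fun t ht =>
    (harc le_rfl ht.2).ang_eq hV ⟨ht.1, le_rfl⟩
  have hcc : ContinuousAt x c := (h.cont c ⟨hc0.le, hcb⟩).continuousAt (Ico_mem_nhds hc0 hcb)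
  have hnorm : Tendsto (fun t => ‖x t‖) (𝓝[<] c) (𝓝 0) := by
    have : Tendsto (fun t => ‖x t‖) (𝓝 c) (𝓝 ‖x c‖) := hcc.norm
    rw [hx, norm_zero] at this
    exact this.mono_left nhdsWithin_le_nhds
  have hmem : ∀ᶠ t in 𝓝[<] c, t ∈ Ico d c := Ico_mem_nhdsLT hd.2
  have hnorm' : Tendsto (fun t => ‖x t‖) (𝓝[<] c) (𝓝[>] 0) :=
    tendsto_nhdsWithin_iff.2 ⟨hnorm, hmem.mono fun t ht => norm_pos_iff.2 (hne t ht).1⟩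
  -- Lagrange's identity equates `2 r² (E + V)`, at the actual energy, with `(x · ẋ)² + ℓ²`. Hence
  -- `ℓ = 0` and `x · ẋ → 0`.
  have hlim := ((tendsto_sq_mul_energy hV (hρ.mono hE)).comp hnorm').const_mul 2
  rw [mul_zero] at hlim
  have hsum : Tendsto (fun t => (inner ℝ (x t) (v t) : ℝ) ^ 2 + ang (x d, v d) ^ 2) (𝓝[<] c)
      (𝓝 0) := by
    refine hlim.congr' (hmem.mono fun t ht => ?_)
    have h1 := inner_sq_add_ang_sq (x t, v t)
    rw [hang t ht, norm_snd_sq (V := V) (x t, v t), henergy t ht] at h1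
    simp only at h1
    simp only [Function.comp_apply]
    linarith
  have hℓ : ang (x d, v d) = 0 := by
    have h1 : ang (x d, v d) ^ 2 ≤ 0 :=
      ge_of_tendsto' hsum fun t => le_add_of_nonneg_left (sq_nonneg _)
    exact pow_eq_zero_iff two_ne_zero |>.1 (le_antisymm h1 (sq_nonneg _))
  refine ⟨hℓ, fun t ht => ?_, ?_⟩
  -- If `x · ẋ ≥ 0` at some time, convexity keeps `|x|` from decreasing and thus from reaching the
  -- centre.
  · by_contra! hcon
    have h1 : ‖x t‖ ^ 2 ≤ 0 ^ 2 := by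
      refine ge_of_tendsto (hnorm.pow 2) ?_
      filter_upwards [Ioo_mem_nhdsLT ht.2] with s hs
      have := (harc ht.1 hs.2).norm_sq_sub_ge hV hρ hs.1.le
        (fun u hu => (hne u ⟨ht.1.trans hu.1, hu.2.trans_lt hs.2⟩).2.le)
        (by rw [henergy t ht]; exact hE)
      simp only at this
      nlinarith [mul_nonneg hcon (sub_pos.2 hs.1).le, sq_nonneg (s - t)]
    have h2 := pow_pos (norm_pos_iff.2 (hne t ht).1) 2
    simp only [ne_eq, OfNat.ofNat_ne_zero, not_false_eq_true, zero_pow] at h1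
    linarith
  · rw [hℓ] at hsum
    have h1 := hsum.sqrt
    simp only [ne_eq, OfNat.ofNat_ne_zero, not_false_eq_true, zero_pow, add_zero, Real.sqrt_zero,
      Real.sqrt_sq_eq_abs] at h1
    exact (tendsto_zero_iff_abs_tendsto_zero _).2 h1

/-- The velocity after a collision. -/
lemma velocity_after_collision (h : IsExtendedMotion V y b x v) {c η s : ℝ}
    (hr : ∀ s ∈ Ioo 0 η, x (c + s) = -x (c - s)) (hs : s ∈ Ioo 0 η) (hsc : s < c)
    (hsb : c + s < b) (hne : x (c - s) ≠ 0) : v (c + s) = v (c - s) := by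
  have hne' : x (c + s) ≠ 0 := by rw [hr s hs]; exact neg_ne_zero.2 hne
  have hbound : 0 < s := hs.1
  have h1 : HasDerivAt x (v (c + s)) (c + s) :=
    (h.solves (c + s) ⟨by linarith, hsb⟩ hne').1.hasDerivAt (Ici_mem_nhds (by linarith))
  have h2 : HasDerivAt x (v (c - s)) (c - s) :=
    (h.solves (c - s) ⟨by linarith, by linarith⟩ hne).1.hasDerivAt (Ici_mem_nhds (by linarith))
  have h3 : HasDerivAt (fun u => 2 * c - u) (-1) (c + s) := by
    simpa using (hasDerivAt_id (c + s)).const_sub (2 * c)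
  have h4 : HasDerivAt (fun u => -x (2 * c - u)) (v (c - s)) (c + s) := by
    rw [show c - s = 2 * c - (c + s) by ring] at h2 ⊢
    simpa using! (h2.scomp (c + s) h3).neg
  refine h1.unique (h4.congr_of_eventuallyEq ?_)
  filter_upwards [Ioo_mem_nhds (show c < c + s by linarith) (show c + s < c + η by linarith [hs.2])]
    with u hu
  have := hr (u - c) ⟨by linarith [hu.1], by linarith [hu.2]⟩
  rwa [add_sub_cancel, show c - (u - c) = 2 * c - u by ring] at this

lemma ang_neg_left (p u : Plane) : ang (-p, u) = -ang (p, u) := by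
  simp only [ang, PiLp.neg_apply]
  ring

/-- The extended flow depends continuously on the datum; energy and angular momentum are
conserved. -/
lemma stableState_and_conserved {R : ℝ} (hV : ClassVStar V) (hR : IsAdmissibleRadius V R)
    (h : IsExtendedMotion V y b x v) : ∀ t ∈ Ico 0 b, x t ≠ 0 →
      StableState V y t (x t, v t) ∧ energy V (x t, v t) = energy V y ∧
        ang (x t, v t) = ang y := by
  have hVs := hV.smooth
  have hadv : ∀ {t u : ℝ}, 0 ≤ t → t < u → u < b → (∀ s ∈ Icc t u, x s ≠ 0) →
      (StableState V y t (x t, v t) ∧ energy V (x t, v t) = energy V y ∧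
        ang (x t, v t) = ang y) →
      StableState V y u (x u, v u) ∧ energy V (x u, v u) = energy V y ∧
        ang (x u, v u) = ang y := by
    intro t u ht htu hub hne ⟨h1, h2, h3⟩
    have harc := h.isArc ht hub hne
    have h4 := h1.trans ht (sub_pos.2 htu) (h.stableState_arc hVs ht htu.le hub hne)
    rw [add_sub_cancel] at h4
    exact ⟨h4, (harc.energy_eq hVs ⟨htu.le, le_rfl⟩).trans h2,
      (harc.ang_eq hVs ⟨htu.le, le_rfl⟩).trans h3⟩
  refine real_induction (fun hx0 => ?_) (fun t ht hP hxt => ?_) (fun t ht hP => ?_)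
  · by_cases hb : 0 < b
    · refine ⟨h.stableState_of_ne_zero hVs 0 ⟨le_rfl, hb⟩ fun s hs => ?_, ?_, ?_⟩
      · rwa [le_antisymm hs.2 hs.1]
      · rw [h.state_zero]
      · rw [h.state_zero]
    -- `real_induction` asks for the base case even when `b ≤ 0`; the local motion then supplies the
    -- stability.
    · refine ⟨?_, by rw [h.state_zero], by rw [h.state_zero]⟩
      obtain ⟨r, hr, ε, hε, hl⟩ := exists_local_motion hVs h.ne_zero
      obtain ⟨x', v', hm, hs⟩ := hl y (Metric.mem_ball_self hr)
      have := (hs 0 ⟨le_rfl, hε⟩).2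
      rw [h.state_zero]
      rwa [hm.state_zero] at this
  · have hc : ContinuousAt x t :=
      (h.cont t ⟨ht.1.le, ht.2⟩).continuousAt (Ico_mem_nhds ht.1 ht.2)
    obtain ⟨s, hs, hsub⟩ := mem_nhdsLE_iff_exists_Icc_subset.1
      (nhdsWithin_le_nhds (s := Iic t) ((hc.eventually_ne hxt).and (Ioi_mem_nhds ht.1)))
    have hst : s < t := hs
    have hs0 : 0 < s := (hsub ⟨le_rfl, hst.le⟩).2
    exact hadv hs0.le hst ht.2 (fun u hu => (hsub hu).1)
      (hP s ⟨hs0.le, hst⟩ (hsub ⟨le_rfl, hst.le⟩).1)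
  · by_cases hxt : x t = 0
    · have ht0 := h.pos_of_eq_zero ht.1 hxt
      have htb : t ∈ Ioo 0 b := ⟨ht0, ht.2⟩
      -- Lowering the energy by `1` gives the strict inequality that persists for nearby data.
      obtain ⟨ρ, hρ⟩ := exists_scatteringRadius hV hR (energy V y - 1)
      have hlog : ∀ ε > 0, ∃ κ > 0, ∀ r ∈ Ioc 0 κ,
          -r * deriv V r ≤ ε * (energy V y - 1 + V r) := fun ε hε => by
        obtain ⟨κ, hκ, hsub⟩ := mem_nhdsGT_iff_exists_Ioc_subset.1
          (eventually_virial_le hV hR (energy V y - 1) hε)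
        exact ⟨κ, hκ, fun r hr => (hsub hr).2⟩
      have hP' : ∀ s ∈ Ico 0 t, x s ≠ 0 → _ := fun s hs => hP s ⟨hs.1, hs.2.le⟩
      obtain ⟨d, hd, hne⟩ := h.exists_forall_ne_zero_left hVs hρ htb hxt fun s hs hxs => by
        rw [(hP' s hs hxs).2.1]; linarith
      have hPd : ∀ s ∈ Ico d t, StableState V y s (x s, v s) ∧
          energy V (x s, v s) = energy V y ∧ ang (x s, v s) = ang y := fun s hs =>
        hP' s ⟨hd.1.trans hs.1, hs.2⟩ (hne s hs).1
      obtain ⟨hℓ, hin, hlim⟩ := h.before_collision hVs hρ hd ht.2 hxt hne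
        (by rw [(hPd d ⟨le_rfl, hd.2⟩).2.1]; linarith)
      have hℓy : ang y = 0 := by rw [← (hPd d ⟨le_rfl, hd.2⟩).2.2, hℓ]
      obtain ⟨η, hη, hr⟩ := h.transmission t htb hxt
      set ζ := min η (min (t - d) (b - t)) with hζ
      have hζ1 : ζ ≤ η := min_le_left _ _
      have hζ2 : ζ ≤ t - d := (min_le_right _ _).trans (min_le_left _ _)
      have hζ3 : ζ ≤ b - t := (min_le_right _ _).trans (min_le_right _ _)
      have hζ0 : 0 < ζ := lt_min hη (lt_min (sub_pos.2 hd.2) (sub_pos.2 ht.2))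
      have hbef : ∀ s ∈ Ioo 0 ζ, t - s ∈ Ico d t := fun s hs =>
        ⟨by linarith [hs.2], by linarith [hs.1]⟩
      have haft : ∀ s ∈ Ioo 0 ζ, (x (t + s), v (t + s)) = (-x (t - s), v (t - s)) := fun s hs => by
        have hs' : s ∈ Ioo 0 η := ⟨hs.1, hs.2.trans_le hζ1⟩
        rw [hr s hs', h.velocity_after_collision hr hs' (by linarith [hs.2, hd.1])
          (by linarith [hs.2]) (hne _ (hbef s hs)).1]
      have haftne : ∀ s ∈ Ioo 0 ζ, x (t + s) ≠ 0 := fun s hs => by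
        rw [hr s ⟨hs.1, hs.2.trans_le hζ1⟩]
        exact neg_ne_zero.2 (hne _ (hbef s hs)).1
      -- Three stages: to a state just before the collision, through the centre to nearly its
      -- antipodal state, which is the transmitted state at `t + s`, and along a regular arc to `t +
      -- s₀`.
      have hnear : ∀ s₀ ∈ Ioo 0 ζ, NearlyReaches V y (t + s₀) (x (t + s₀), v (t + s₀)) := by
        intro s₀ hs₀ U hU ε hε
        -- This limits the passage to `ε / 2`. The other timing errors are `ε / 8` on arrival, `ε /
        -- 4` on the last arc, and `2s < ε / 4` for the skipped time.
        have hev : ∀ᶠ u in 𝓝[<] t, -(ε / 10) < (inner ℝ (x u) (v u) : ℝ) :=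
          hlim.eventually_const_lt (by linarith)
        have hlt : max (t - s₀) (t - ε / 8) < t := max_lt (by linarith [hs₀.1]) (by linarith)
        obtain ⟨u, hu, hut⟩ := (hev.and (Ioo_mem_nhdsLT hlt)).exists
        have hu1 := (le_max_left _ _).trans_lt hut.1
        have hu2 := (le_max_right _ _).trans_lt hut.1
        set s := t - u with hs
        have hsζ : s ∈ Ioo 0 ζ := ⟨by linarith [hut.2], by linarith [hs₀.2]⟩
        have hss₀ : s < s₀ := by linarith
        have hu' : u = t - s := by rw [hs]; ring
        have hud : u ∈ Ico d t := hu' ▸ hbef s hsζ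
        have hstep1 := (hPd u hud).1
        have hstep3 : StableState V (x (t + s), v (t + s)) (t + s₀ - (t + s))
            (x (t + s₀), v (t + s₀)) :=
          h.stableState_arc hVs (by linarith [hsζ.1]) (by linarith) (by linarith [hs₀.2])
            fun r hr' => by
              have := haftne (r - t) ⟨by linarith [hr'.1, hsζ.1], by linarith [hr'.2, hs₀.2]⟩
              rwa [add_sub_cancel] at this
        have hA := hstep3.nearlyReaches (by linarith) U hU (ε / 4) (by linarith)
        rw [haft s hsζ, ← hu'] at hA
        have hB := eventually_passage hVs hρ hlog (z := (x u, v u)) (hne u hud).1 (hne u hud).2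
          (by rw [(hPd u hud).2.1]; linarith) (hin u hud) ((hPd u hud).2.2.trans hℓy) hA
        have hC := hstep1.nearlyReaches (hd.1.trans hud.1) _ hB (ε / 8) (by linarith)
        filter_upwards [hC] with y' ⟨t₁, ht₁, ht₁', z₁, ⟨t₂, ht₂, z₂, hz₂, hst₂⟩, hst₁⟩
        obtain ⟨t₃, ht₃, ht₃', z₃, hz₃, hst₃⟩ := hz₂
        rw [abs_lt] at ht₁' ht₃'
        refine ⟨t₁ + t₂ + t₃, by linarith [ht₂.1], ?_, z₃, hz₃, (hst₁.trans hst₂).trans hst₃⟩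
        rw [abs_lt]
        constructor <;> linarith [ht₁'.1, ht₁'.2, ht₃'.1, ht₃'.2, ht₂.1, ht₂.2, hut.2]
      refine ⟨ζ, hζ0, fun u hu hub hxu => ?_⟩
      have hs : u - t ∈ Ioo 0 ζ := ⟨by linarith [hu.1], by linarith [hu.2]⟩
      have hstate := haft _ hs
      have hPu := hPd _ (hbef _ hs)
      rw [add_sub_cancel] at hstate
      refine ⟨?_, ?_, ?_⟩
      -- Half of the time after the collision is kept for a regular arc, which upgrades
      -- `NearlyReaches` to `StableState`.
      · set s₀ := (u - t) / 2
        have hs₀ : s₀ ∈ Ioo 0 ζ := ⟨half_pos hs.1, (half_lt_self hs.1).trans hs.2⟩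
        have hs₀' : s₀ < u - t := half_lt_self hs.1
        have hs₀u : t + s₀ < u := by linarith
        have h1 := h.stableState_arc hVs (by linarith [hs₀.1]) hs₀u.le hub fun r hr' => by
          have := haftne (r - t) ⟨by linarith [hr'.1, hs₀.1], by linarith [hr'.2, hs.2]⟩
          rwa [add_sub_cancel] at this
        have h2 := (hnear s₀ hs₀).trans_stableState (sub_pos.2 hs₀u) h1
        rwa [add_sub_cancel] at h2
      · rw [hstate, ← hPu.2.1, energy, energy, norm_neg]
      -- Transmission reverses the angular momentum, which is harmless because it vanishes on
      -- colliding motions.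
      · rw [hstate, ang_neg_left, hPu.2.2, hℓy, neg_zero]
    · have hc : ContinuousWithinAt x (Ico t b) t :=
        (h.cont t ht).mono (Ico_subset_Ico_left ht.1)
      have hev : ∀ᶠ s in 𝓝[≥] t, x s ≠ 0 := by
        rw [← nhdsWithin_Ico_eq_nhdsGE ht.2]
        exact hc.eventually_ne hxt
      obtain ⟨q, hq, hsub⟩ := mem_nhdsGE_iff_exists_Ico_subset.1 hev
      have hq' : t < q := hq
      exact ⟨q - t, sub_pos.2 hq', fun u hu hub _ => hadv ht.1 hu.1 hub
        (fun s hs => hsub ⟨hs.1, by linarith [hs.2, hu.2]⟩) (hP t ⟨ht.1, le_rfl⟩ hxt)⟩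

end IsExtendedMotion

/-! ### Continuity of the extended flow -/

section Flow

variable {V : ℝ → ℝ} {R : ℝ}

lemma stableState_flow (hV : ClassVStar V) (hR : IsAdmissibleRadius V R) {y : Phase} {t : ℝ}
    (h : (y, t) ∈ flowDomain V) : StableState V y t (flow V y t) := by
  obtain ⟨z, hz⟩ := h
  rw [flow_eq hV.smooth hz]
  obtain ⟨h0, b, x, v, hb, hm, hx, rfl⟩ := hz
  exact (hm.stableState_and_conserved hV hR t ⟨h0, hb⟩ hx).1

lemma eventually_mem_flowDomain (hV : ClassVStar V) (hR : IsAdmissibleRadius V R) {p : Phase × ℝ}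
    (h : p ∈ flowDomain V) (hp : 0 < p.2) : ∀ᶠ q in 𝓝 p, q ∈ flowDomain V := by
  filter_upwards [stableState_flow hV hR h univ univ_mem,
    (continuous_snd.tendsto p).eventually_const_lt hp] with q hq hq0
  obtain ⟨z, _, hz⟩ := hq hq0.le
  exact ⟨z, hz⟩

lemma continuousAt_flow (hV : ClassVStar V) (hR : IsAdmissibleRadius V R) {p : Phase × ℝ}
    (h : p ∈ flowDomain V) (hp : 0 < p.2) :
    ContinuousAt (fun q : Phase × ℝ => flow V q.1 q.2) p := by
  intro U hU
  rw [mem_map]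
  filter_upwards [stableState_flow hV hR h U hU,
    (continuous_snd.tendsto p).eventually_const_lt hp] with q hq hq0
  obtain ⟨z, hz, hst⟩ := hq hq0.le
  simpa only [mem_preimage, flow_eq hV.smooth hst] using hz

lemma flow_fst_ne_zero (hV : ContDiffOn ℝ ∞ V (Ioi 0)) {y : Phase} {t : ℝ}
    (h : (y, t) ∈ flowDomain V) : (flow V y t).1 ≠ 0 := by
  obtain ⟨z, hz⟩ := h
  rw [flow_eq hV hz]
  exact hz.ne_zero

/-- Off the collision instants the flow coincides locally in time with a single motion, whatever
motion the definition chooses at each time. -/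
lemma hasDerivAt_flow (hV : ContDiffOn ℝ ∞ V (Ioi 0)) {y : Phase} {t : ℝ}
    (h : (y, t) ∈ flowDomain V) (ht : 0 < t) :
    HasDerivAt (flow V y) (field V (flow V y t)) t := by
  obtain ⟨z, hz⟩ := h
  rw [flow_eq hV hz]
  obtain ⟨h0, b, x, v, hb, hm, hx, rfl⟩ := hz
  refine (hm.hasDerivAt ⟨ht, hb⟩ hx).congr_of_eventuallyEq ?_
  have hc : ContinuousAt x t := (hm.cont t ⟨h0, hb⟩).continuousAt (Ico_mem_nhds ht hb)
  filter_upwards [hc.eventually_ne hx, Ioo_mem_nhds ht hb] with s hs hsb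
  exact flow_eq hV (hm.isStateAt ⟨hsb.1.le, hsb.2⟩ hs)

end Flow

/-! ### The Poincaré section -/

/-- The zeros of a continuous family of strictly increasing functions depend continuously on the
parameter. -/
lemma exists_continuousOn_zero {X : Type*} [PseudoMetricSpace X] {g : X → ℝ → ℝ} {x₀ : X}
    {T δ η : ℝ} (hδ : 0 < δ) (hη : 0 < η)
    (hc : ∀ x ∈ Metric.ball x₀ δ, ∀ t ∈ Ioo (T - η) (T + η), ContinuousAt (fun x => g x t) x)
    (hct : ∀ x ∈ Metric.ball x₀ δ, ContinuousOn (g x) (Ioo (T - η) (T + η)))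
    (hmono : ∀ x ∈ Metric.ball x₀ δ, StrictMonoOn (g x) (Ioo (T - η) (T + η)))
    (h0 : g x₀ T = 0) :
    ∃ δ' > 0, δ' ≤ δ ∧ ∃ τ : X → ℝ, ContinuousOn τ (Metric.ball x₀ δ') ∧ τ x₀ = T ∧
      ∀ x ∈ Metric.ball x₀ δ', τ x ∈ Ioo (T - η) (T + η) ∧ g x (τ x) = 0 := by
  have hx₀ : x₀ ∈ Metric.ball x₀ δ := Metric.mem_ball_self hδ
  have ha : T - η / 2 ∈ Ioo (T - η) (T + η) := ⟨by linarith, by linarith⟩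
  have hb : T + η / 2 ∈ Ioo (T - η) (T + η) := ⟨by linarith, by linarith⟩
  have hT : T ∈ Ioo (T - η) (T + η) := ⟨by linarith, by linarith⟩
  have hneg : g x₀ (T - η / 2) < 0 := h0 ▸ hmono x₀ hx₀ ha hT (by linarith)
  have hpos : 0 < g x₀ (T + η / 2) := by
    have := hmono x₀ hx₀ hT hb (by linarith)
    rwa [h0] at this
  obtain ⟨d, hd, hball⟩ := Metric.eventually_nhds_iff_ball.1
    (((hc x₀ hx₀ _ ha).eventually_lt_const hneg).and
      ((hc x₀ hx₀ _ hb).eventually_const_lt hpos))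
  have hex : ∀ x, ∃ t, x ∈ Metric.ball x₀ (min d δ) → t ∈ Ioo (T - η) (T + η) ∧ g x t = 0 := by
    intro x
    by_cases hx : x ∈ Metric.ball x₀ (min d δ)
    · have hsub : Icc (T - η / 2) (T + η / 2) ⊆ Ioo (T - η) (T + η) :=
        fun t ht => ⟨by linarith [ht.1], by linarith [ht.2]⟩
      have hxd := hball x (Metric.ball_subset_ball (min_le_left _ _) hx)
      obtain ⟨t, ht, h⟩ := intermediate_value_Icc (by linarith)
        ((hct x (Metric.ball_subset_ball (min_le_right _ _) hx)).mono hsub)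
        ⟨hxd.1.le, hxd.2.le⟩
      exact ⟨t, fun _ => ⟨hsub ht, h⟩⟩
    · exact ⟨0, fun h => absurd h hx⟩
  choose τ hτ using hex
  have hmin : 0 < min d δ := lt_min hd hδ
  refine ⟨min d δ, hmin, min_le_right _ _, τ, fun x hx => ?_, ?_, hτ⟩
  · obtain ⟨hmem, hz⟩ := hτ x hx
    have hxδ : ∀ x' ∈ Metric.ball x₀ (min d δ), x' ∈ Metric.ball x₀ δ :=
      Metric.ball_subset_ball (min_le_right _ _)
    have hev : ∀ᶠ x' in 𝓝 x, x' ∈ Metric.ball x₀ (min d δ) := Metric.isOpen_ball.mem_nhds hx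
    refine ContinuousAt.continuousWithinAt (tendsto_order.2 ⟨fun a ha => ?_, fun a ha => ?_⟩)
    -- The negative sign of `g x s` persists for `x'` near `x`, and monotonicity then forces `τ x' >
    -- s > a`.
    · obtain ⟨s, hs1, hs2⟩ := exists_between (max_lt ha hmem.1)
      have hs : s ∈ Ioo (T - η) (T + η) :=
        ⟨(le_max_right _ _).trans_lt hs1, hs2.trans hmem.2⟩
      have hlt : g x s < 0 := hz ▸ hmono x (hxδ x hx) hs hmem hs2
      filter_upwards [hev, (hc x (hxδ x hx) s hs).eventually_lt_const hlt] with x' hx' hx's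
      rw [← (hτ x' hx').2, (hmono x' (hxδ x' hx')).lt_iff_lt hs (hτ x' hx').1] at hx's
      exact ((le_max_left _ _).trans_lt hs1).trans hx's
    · obtain ⟨s, hs1, hs2⟩ := exists_between (lt_min ha hmem.2)
      have hs : s ∈ Ioo (T - η) (T + η) :=
        ⟨hmem.1.trans hs1, hs2.trans_le (min_le_right _ _)⟩
      have hlt : 0 < g x s := hz ▸ hmono x (hxδ x hx) hmem hs hs1
      filter_upwards [hev, (hc x (hxδ x hx) s hs).eventually_const_lt hlt] with x' hx' hx's
      rw [← (hτ x' hx').2, (hmono x' (hxδ x' hx')).lt_iff_lt (hτ x' hx').1 hs] at hx's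
      exact hx's.trans (hs2.trans_le (min_le_left _ _))
  · obtain ⟨hmem, hz⟩ := hτ x₀ (Metric.mem_ball_self hmin)
    exact (hmono x₀ hx₀).injOn hmem hT (hz.trans h0.symm)

/-- The scalar product with `F`, as a continuous linear map. -/
def dotCLM (F : Phase) : Phase →L[ℝ] ℝ :=
  (innerSL ℝ F.1).comp (ContinuousLinearMap.fst ℝ Plane Plane) +
    (innerSL ℝ F.2).comp (ContinuousLinearMap.snd ℝ Plane Plane)

lemma dotCLM_apply (F y : Phase) : dotCLM F y = dot y F := by
  simp [dotCLM, dot, real_inner_comm]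

/-- The Poincaré section of the extended flow through a transversal hyperplane. -/
theorem exists_poincare_section {V : ℝ → ℝ} {R : ℝ} (hV : ClassVStar V)
    (hR : IsAdmissibleRadius V R) {y₀ : Phase} {T : ℝ} (hT : 0 < T) (hdom : (y₀, T) ∈ flowDomain V)
    {F : Phase} (hF : IsTransversal V (flow V y₀ T) F) :
    ∃ δ : ℝ, 0 < δ ∧ ∃ τ : Phase → ℝ, ContinuousOn τ (Metric.ball y₀ δ) ∧ τ y₀ = T ∧
      (∀ y ∈ Metric.ball y₀ δ, (y, τ y) ∈ flowDomain V ∧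
        flow V y (τ y) ∈ hyperplane (flow V y₀ T) F) ∧
      ContinuousOn (fun y => flow V y (τ y)) (Metric.ball y₀ δ) := by
  set y₁ := flow V y₀ T
  -- Multiplying by `σ` makes the crossing derivative positive whichever way the flow traverses the
  -- hyperplane.
  set σ := dotCLM F (field V y₁) with hσ
  have hσ0 : σ ≠ 0 := by rw [hσ, dotCLM_apply]; exact hF
  have hfield : ContinuousAt (fun q : Phase × ℝ => σ * dotCLM F (field V (flow V q.1 q.2)))
      (y₀, T) := by
    have h1 := (contDiffAt_field hV.smooth (flow_fst_ne_zero hV.smooth hdom)).continuousAt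
    exact continuousAt_const.mul ((dotCLM F).continuous.continuousAt.comp
      (ContinuousAt.comp (g := field V) h1 (continuousAt_flow hV hR hdom hT)))
  have hpos : 0 < σ * dotCLM F (field V (flow V y₀ T)) := mul_self_pos.2 hσ0
  have hev := (eventually_mem_flowDomain hV hR hdom hT).and
    ((hfield.eventually_const_lt hpos).and
      ((continuous_snd.tendsto (y₀, T)).eventually_const_lt hT))
  -- In the sup metric a ball of the product is a box, so one `δ` serves for both the data and the
  -- times.
  obtain ⟨δ, hδ, hball⟩ := Metric.eventually_nhds_iff_ball.1 hev
  have hbox : ∀ y ∈ Metric.ball y₀ δ, ∀ t ∈ Ioo (T - δ) (T + δ), (y, t) ∈ flowDomain V ∧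
      0 < σ * dotCLM F (field V (flow V y t)) ∧ 0 < t := fun y hy t ht =>
    hball (y, t) (by
      rw [← ball_prod_same, Real.ball_eq_Ioo]
      exact ⟨hy, ht⟩)
  set g : Phase → ℝ → ℝ := fun y t => σ * dotCLM F (flow V y t - y₁) with hg
  have hderiv : ∀ y ∈ Metric.ball y₀ δ, ∀ t ∈ Ioo (T - δ) (T + δ),
      HasDerivAt (g y) (σ * dotCLM F (field V (flow V y t))) t := fun y hy t ht =>
    ((dotCLM F).hasFDerivAt.comp_hasDerivAt t ((hasDerivAt_flow hV.smooth (hbox y hy t ht).1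
      (hbox y hy t ht).2.2).sub_const y₁)).const_mul σ
  have hflow : ∀ y ∈ Metric.ball y₀ δ, ∀ t ∈ Ioo (T - δ) (T + δ),
      ContinuousAt (fun q : Phase × ℝ => flow V q.1 q.2) (y, t) := fun y hy t ht =>
    continuousAt_flow hV hR (hbox y hy t ht).1 (hbox y hy t ht).2.2
  obtain ⟨δ', hδ', hle, τ, hτc, hτ0, hτ⟩ := exists_continuousOn_zero (g := g) (x₀ := y₀) (T := T)
    hδ hδ
    (fun y hy t ht => by
      have h1 : ContinuousAt (fun y => flow V y t) y :=
        ContinuousAt.comp (g := fun q : Phase × ℝ => flow V q.1 q.2) (f := fun y => (y, t))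
          (hflow y hy t ht) (Continuous.prodMk_left t).continuousAt
      exact continuousAt_const.mul ((dotCLM F).continuous.continuousAt.comp
        (h1.sub continuousAt_const)))
    (fun y hy t ht => (hderiv y hy t ht).continuousAt.continuousWithinAt)
    (fun y hy => strictMonoOn_of_deriv_pos (convex_Ioo _ _)
      (fun t ht => (hderiv y hy t ht).continuousAt.continuousWithinAt)
      fun t ht => by
        have ht' := interior_subset ht
        rw [(hderiv y hy t ht').deriv]
        exact (hbox y hy t ht').2.1)
    (by simp [hg, y₁])
  have hsub : Metric.ball y₀ δ' ⊆ Metric.ball y₀ δ := Metric.ball_subset_ball hle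
  refine ⟨δ', hδ', τ, hτc, hτ0, fun y hy => ⟨(hbox y (hsub hy) _ (hτ y hy).1).1, ?_⟩,
    fun y hy => ?_⟩
  · have := (mul_eq_zero.1 (hτ y hy).2).resolve_left hσ0
    rwa [dotCLM_apply] at this
  · exact ContinuousAt.comp_continuousWithinAt (g := fun q : Phase × ℝ => flow V q.1 q.2)
      (f := fun y => (y, τ y)) (hflow y (hsub hy) _ (hτ y hy).1)
      (continuousWithinAt_id.prodMk (hτc y hy))

end OneCentre

end

theorem mainTheorem5 (V : ℝ → ℝ) (hV : OneCentre.ClassVStar V)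
    (R : ℝ) (hR : OneCentre.IsAdmissibleRadius V R)
    (ybar : OneCentre.Phase) (T₀ : ℝ) (hcoll : OneCentre.IsCollisionDatum V R ybar T₀)
    (T : ℝ) (hT : T₀ < T) (hdom : (ybar, T) ∈ OneCentre.flowDomain V)
    (y₁ : OneCentre.Phase) (hy₁ : y₁ = OneCentre.flow V ybar T)
    (F : OneCentre.Phase) (hF : OneCentre.IsTransversal V y₁ F) :
    ∃ δ : ℝ, 0 < δ ∧ ∃ τ : OneCentre.Phase → ℝ,
      ContinuousOn τ (Metric.ball ybar δ) ∧
      τ ybar = T ∧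
      (∀ y ∈ Metric.ball ybar δ, (y, τ y) ∈ OneCentre.flowDomain V ∧
        OneCentre.flow V y (τ y) ∈ OneCentre.hyperplane y₁ F) ∧
      ContinuousOn (fun y => OneCentre.flow V y (τ y)) (Metric.ball ybar δ) := by
  subst hy₁
  exact OneCentre.exists_poincare_section hV hR (hcoll.1.trans hT) hdom hF
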